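/- **Setting.** Let $\mathbb K$ be a field of characteristic zero; vector spaces are super ($\mathbb Z/2$-graded) vector spaces, $\tilde a$ is the parity of a homogeneous vector $a$. Write $\check z=(z,\bar z)$, $\check n=(n,\bar n)\in\mathbb K^2$, $\check z^{\check n}=z^n\bar z^{\bar n}$, $1=(1,1)$, $\binom{\check h}{\check i}=\binom{h}{i}\binom{\bar h}{\bar i}$ for $\check i\in\mathbb N^2$, and $\check{\mathbb K}=\{\check h\in\mathbb K^2 : h-\bar h\in\mathbb Z\}$. A $W$-valued distribution is a formal sum $a(\check z)=\sum_{\check n\in\mathbb K^2}a_{\check n}\check z^{-\check n-1}$ with $a_{\check n}\in W$ (similarly in several variables). It is bounded by $\check h_1,\dots,\check h_r\in\mathbb K^2$ if it lies in $\sum_i\check z^{-\check h_i}W[[\check z]]$. It is a vertex series if it is bounded by some finite family; likewise a vertex series in $\check z,\check w$ is an element of a finite sum $\sum_i\check z^{-\check h_i}\check w^{-\check h_i'}W[[\check z,\check w]]$. For $\nu=\pm1$ put $(\check z+\nu\check w)^{\check h}=\sum_{\check i\in\mathbb N^2}\binom{\check h}{\check i}\nu^{i+\bar i}\check z^{\check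 h-\check i}\check w^{\check i}$, and for $\check h\in\check{\mathbb K}$ put $(\check z-\check w)^{\check h}_{w>z}=(-1)^{h-\bar h}(\check w-\check z)^{\check h}$. A $\check{\mathbb K}$-fold module $M$ over a vector space $V$ is a vector space with even bilinear products $V\times M\to M$, $(a,c)\mapsto a_{(\check n)}c$, for $\check n\in\check{\mathbb K}$ (put $a_{(\check n)}=0$ for $\check n\notin\check{\mathbb K}$); $a(\check z)=\sum a_{(\check n)}\check z^{-\check n-1}$. It is bounded if $a(\check z)c$ is a vertex series for all $a\in V$, $c\in M$. A $\check{\mathbb K}$-fold algebra is a $\check{\mathbb K}$-fold module over itself. A pair $\check T=(T,\bar T)$ of even operators of $V$ is a translation endomorphism of $M$ if $(Ta)(\check z)=\partial_z a(\check z)$ and $(\bar Ta)(\check z)=\partial_{\bar z}a(\check z)$ on $M$ for all $a\in V$. Let $M$ be a bounded $\check{\mathbb K}$-fold module over a bounded $\check{\mathbb K}$-fold algebra $V$ and let $a,b\in V$ be homogeneous. * *Duality.* $a$ and $b$ are *dual on $M$ of orders at most $\check h_1,\dots,\check h_r\in\check{\mathbb K}$* if for every $c\in M$ there are finitely many $\check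 k_j\in\check{\mathbb K}$ and $M$-valued vertex series $d^j(\check z,\check w)$, bounded in $\check z$ by $\check h_1,\dots,\check h_r$, with $$a(\check x+\check w)b(\check w)c=\sum_j\frac{d^j(\check x,\check w)}{(\check x+\check w)^{\check k_j}},\qquad (a(\check x)b)(\check w)c=\sum_j\frac{d^j(\check x,\check w)}{(\check w+\check x)^{\check k_j}},$$ where $a(\check x+\check w)=\sum_{\check n}a_{(\check n)}(\check x+\check w)^{-\check n-1}$. They are *dual on $M$ with pole orders $\check h_1,\dots,\check h_r\in\check{\mathbb K}$* if the $\check h_i$ are pairwise incongruent modulo $\mathbb Z^2$ and, for $\check n_1,\dots,\check n_r\in\mathbb N^2$, they are dual on $M$ of orders at most $\check h_1-\check n_1,\dots,\check h_r-\check n_r$ if and only if all $\check n_i=0$. * *Skew-symmetry.* $a$ and $b$ *satisfy skew-symmetry for $\check T$* if $a(\check z)b$ is a vertex series and for all $\check n\in\check{\mathbb K}$ $$(-1)^{\tilde a\tilde b}\,b_{(\check n)}a=\sum_{\check i\in\mathbb N^2}(-1)^{n-\bar n+i+\bar i}\,\frac{T^{i}}{i!}\frac{\bar T^{\bar i}}{\bar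 i!}\bigl(a_{(\check n+\check i)}b\bigr).$$ * *Locality.* An $\operatorname{End}(M)$-valued distribution $c(\check z,\check w)$ is a field if $c(\check z,\check w)v$ is a vertex series for every $v\in M$. $a$ and $b$ are *mutually local on $M$ with pole orders $\check h_1,\dots,\check h_r$* if all $\check h_i\in\check{\mathbb K}$ and there are fields $c^i(\check z,\check w)$ with $$a(\check z)b(\check w)=\sum_{i=1}^r\frac{c^i(\check z,\check w)}{(\check z-\check w)^{\check h_i}},\qquad (-1)^{\tilde a\tilde b}\,b(\check w)a(\check z)=\sum_{i=1}^r\frac{c^i(\check z,\check w)}{(\check z-\check w)^{\check h_i}_{w>z}},$$ such that the first expansion is reduced, i.e. the $\check h_i$ are pairwise incongruent modulo $\mathbb Z^2$ and $(\check z-\check w)^{-\check n}c^i(\check z,\check w)$ is not a field for any $i$ and any $\check n\in\mathbb N^2\setminus\{0\}$. **Proposition.** Let $M$ be a bounded $\check{\mathbb K}$-fold module over a bounded $\check{\mathbb K}$-fold algebra $V$, let $\check T$ be a pair of even operators of $V$ that is a translation endomorphism of $M$, and let $a,b\in V$ be homogeneous. Suppose that $a,b$ are dual on $M$ with pole orders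 $\check h_{ab}^1,\dots,\check h_{ab}^r$, that $b,a$ are dual on $M$ with pole orders $\check h_{ba}^1,\dots,\check h_{ba}^s$, and that $a$ and $b$ satisfy skew-symmetry for $\check T$. Then $a$ and $b$ are mutually local on $M$ with pole orders $\check h_{ab}^1,\dots,\check h_{ab}^r$. Moreover $r=s$, and there is a permutation $\sigma$ of $\{1,\dots,r\}$ such that $\check h_{ba}^i=\check h_{ab}^{\sigma i}$ for all $i$. -/

import Mathlib

namespace OPEAlg

/-- The group `Ǩ` of pairs `(h, h̄)` in `K²` such that `h - h̄` is an integer. -/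
def checkK (K : Type*) [Field K] : Set (K × K) :=
  {h | ∃ m : ℤ, h.1 - h.2 = (m : K)}

/-- A pair of natural numbers as an element of `K²`. -/
def natPair (K : Type*) [Field K] (i : ℕ × ℕ) : K × K := ((i.1 : K), (i.2 : K))

/-- Congruence modulo `ℤ²` in `K²`. -/
def IntCongr {K : Type*} [Field K] (h h' : K × K) : Prop :=
  ∃ m m' : ℤ, h - h' = ((m : K), (m' : K))

/-- The binomial coefficient `a (a-1) ⋯ (a-n+1) / n!`. -/
noncomputable def binom {K : Type*} [Field K] (a : K) (n : ℕ) : K :=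
  (∏ j ∈ Finset.range n, (a - (j : K))) / (n.factorial : K)

/-- The binomial coefficient of pairs: the product of the two binomial coefficients. -/
noncomputable def binom₂ {K : Type*} [Field K] (h : K × K) (i : ℕ × ℕ) : K :=
  binom h.1 i.1 * binom h.2 i.2

open Classical in
/-- The sign `(-1)^(h - h̄)` for `h ∈ Ǩ`. -/
noncomputable def checkSign {K : Type*} [Field K] (h : K × K) : K :=
  if ∃ m : ℤ, Even m ∧ h.1 - h.2 = (m : K) then 1 else -1

/-- The supersign `(-1)^(p q)` of two parities. -/
def superSign (K : Type*) [Field K] (p q : ZMod 2) : K := (-1) ^ (p.val * q.val)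

/-- A `W`-valued distribution `∑ a_n z^{-n-1}` in `ž = (z, z̄)`, given by its modes `a_n`,
`n ∈ K²`; here `ž^ň = z^n z̄^n̄` and `1 = (1, 1)`. -/
abbrev Dist (K W : Type*) := K × K → W

/-- A `W`-valued distribution `∑ a_{n,m} z^{-n-1} w^{-m-1}` in `ž` and `w̌`,
given by its modes `a_{n,m}`. -/
abbrev Dist₂ (K W : Type*) := K × K → K × K → W

section Series

variable {K W : Type*} [Field K] [AddCommGroup W]

/-- `f(ž)` is bounded by `h_1, …, h_r`: it lies in `∑_i ž^{-h_i} W⟦ž⟧`, i.e. every exponent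
`-n-1` that occurs in `f` is of the form `-h_i + k` with `k ∈ ℕ²`. -/
def IsBoundedBy (f : Dist K W) {r : ℕ} (h : Fin r → K × K) : Prop :=
  ∀ n, f n ≠ 0 → ∃ i, ∃ k : ℕ × ℕ, n = h i - 1 - natPair K k

/-- `f(ž)` is a vertex series: it lies in `∑_i ž^{-h_i} W⟦ž⟧` for some finite family `h`. -/
def IsVertexSeries (f : Dist K W) : Prop :=
  ∃ (r : ℕ) (h : Fin r → K × K), IsBoundedBy f h

/-- `f(ž, w̌)` is a vertex series: it lies in `∑_i ž^{-h_i} w̌^{-h'_i} W⟦ž, w̌⟧` for some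
finite families `h` and `h'`. -/
def IsVertexSeries₂ (f : Dist₂ K W) : Prop :=
  ∃ (r : ℕ) (h h' : Fin r → K × K), ∀ n m, f n m ≠ 0 →
    ∃ i, ∃ k l : ℕ × ℕ, n = h i - 1 - natPair K k ∧ m = h' i - 1 - natPair K l

variable [Module K W]

/-- The product of `d(ž, w̌)` with
`(ž + ν w̌)^k = ∑_{i ∈ ℕ²} binom k i * ν^i * ž^{k-i} w̌^i` (expansion for `z > w`).
Each mode is a finite sum if `d` is a vertex series. -/
noncomputable def mulPowFst (ν : K) (k : K × K) (d : Dist₂ K W) : Dist₂ K W :=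
  fun n m => ∑ᶠ i : ℕ × ℕ,
    (binom₂ k i * ν ^ (i.1 + i.2)) • d (n + k - natPair K i) (m + natPair K i)

/-- The product of `d(ž, w̌)` with
`(w̌ + ν ž)^k = ∑_{i ∈ ℕ²} binom k i * ν^i * w̌^{k-i} ž^i` (expansion for `w > z`).
Each mode is a finite sum if `d` is a vertex series. -/
noncomputable def mulPowSnd (ν : K) (k : K × K) (d : Dist₂ K W) : Dist₂ K W :=
  fun n m => ∑ᶠ i : ℕ × ℕ,
    (binom₂ k i * ν ^ (i.1 + i.2)) • d (n + natPair K i) (m + k - natPair K i)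

/-- The product of `d(ž, w̌)` with `(ž - w̌)^k`, `k ∈ Ǩ`, expanded for `w > z`:
`(ž - w̌)^k_{w>z} = (-1)^{k - k̄} (w̌ - ž)^k`. -/
noncomputable def mulPowSubOpp (k : K × K) (d : Dist₂ K W) : Dist₂ K W :=
  checkSign k • mulPowSnd (-1) k d

end Series

section Locality

variable {K M : Type*} [Field K] [AddCommGroup M] [Module K M]

/-- The juxtaposition `a(ž) b(w̌)` of `End(M)`-valued distributions; an `End(M)`-valued
distribution in `ž, w̌` is given as a linear map from `M` to `M`-valued distributions. -/
def juxt (a b : Dist K (Module.End K M)) : M →ₗ[K] Dist₂ K M :=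
  LinearMap.pi fun n => LinearMap.pi fun m => a n ∘ₗ b m

/-- The juxtaposition `b(w̌) a(ž)` as a distribution in `ž, w̌`. -/
def juxtOpp (a b : Dist K (Module.End K M)) : M →ₗ[K] Dist₂ K M :=
  LinearMap.pi fun n => LinearMap.pi fun m => b m ∘ₗ a n

/-- An `End(M)`-valued distribution in `ž, w̌` is a field if it is bounded on any vector. -/
def IsField₂ (c : M → Dist₂ K M) : Prop := ∀ v, IsVertexSeries₂ (c v)

/-- The fields `c^i(ž, w̌)` and the `h_i` form an OPE
`A(ž, w̌) = ∑_i c^i(ž, w̌) / (ž - w̌)^{h_i}` (expanded for `z > w`). -/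
def IsOPE (A : M →ₗ[K] Dist₂ K M) {r : ℕ} (h : Fin r → K × K)
    (c : Fin r → (M →ₗ[K] Dist₂ K M)) : Prop :=
  (∀ i, IsField₂ (c i)) ∧ ∀ v, A v = ∑ i, mulPowFst (-1) (-h i) (c i v)

/-- A reduced OPE: the `h_i` are pairwise incongruent modulo `ℤ²` and
`(ž - w̌)^{-n} c^i(ž, w̌)` is not a field for any `i` and any nonzero `n ∈ ℕ²`.
A distribution has at most one reduced OPE (up to renumbering), and the pole orders of the
distribution are the `h_i` of its reduced OPE. -/
def IsReducedOPE (A : M →ₗ[K] Dist₂ K M) {r : ℕ} (h : Fin r → K × K)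
    (c : Fin r → (M →ₗ[K] Dist₂ K M)) : Prop :=
  IsOPE A h c ∧ (∀ i j, i ≠ j → ¬ IntCongr (h i) (h j)) ∧
    ∀ i, ∀ n : ℕ × ℕ, n ≠ 0 →
      ¬ IsField₂ (fun v => mulPowFst (-1) (-natPair K n) (c i v))

/-- Distributions `a(ž)` and `b(ž)` of parities `p` and `q` are mutually local with pole orders
`h_1, …, h_r`: there is a reduced OPE `a(ž) b(w̌) = ∑_i c^i(ž, w̌) / (ž - w̌)^{h_i}` with all
`h_i ∈ Ǩ`, and `(-1)^{pq} b(w̌) a(ž) = ∑_i c^i(ž, w̌) / (ž - w̌)^{h_i}_{w>z}`. -/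
def MutuallyLocalWithPoleOrders (p q : ZMod 2) (a b : Dist K (Module.End K M))
    {r : ℕ} (h : Fin r → K × K) : Prop :=
  ∃ c : Fin r → (M →ₗ[K] Dist₂ K M),
    IsReducedOPE (juxt a b) h c ∧ (∀ i, h i ∈ checkK K) ∧
    ∀ v, superSign K p q • juxtOpp a b v = ∑ i, mulPowSubOpp (-h i) (c i v)

end Locality

/-- A `Ǩ`-fold module `M` over the super vector space `V`: a family of even bilinear products
`a_(n) c`, `n ∈ Ǩ`, extended by zero to all `n ∈ K²`. -/
structure CheckFoldModule {K V M : Type*} [Field K] [AddCommGroup V] [Module K V]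
    [AddCommGroup M] [Module K M] (𝒱 : ZMod 2 → Submodule K V)
    (ℳ : ZMod 2 → Submodule K M) where
  /-- the products `a_(n) c` -/
  prod : K × K → V →ₗ[K] M →ₗ[K] M
  even : ∀ n p q a c, a ∈ 𝒱 p → c ∈ ℳ q → prod n a c ∈ ℳ (p + q)
  prod_eq_zero : ∀ n, n ∉ checkK K → prod n = 0

/-- A `Ǩ`-fold algebra is a `Ǩ`-fold module over itself. -/
abbrev CheckFoldAlgebra {K V : Type*} [Field K] [AddCommGroup V] [Module K V]
    (𝒱 : ZMod 2 → Submodule K V) := CheckFoldModule 𝒱 𝒱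

section Fold

variable {K V M : Type*} [Field K] [AddCommGroup V] [Module K V] [AddCommGroup M] [Module K M]
  {𝒱 : ZMod 2 → Submodule K V} {ℳ : ZMod 2 → Submodule K M}

/-- The `End(M)`-valued distribution `a(ž) = ∑ a_(n) ž^{-n-1}`. -/
def CheckFoldModule.field (Y : CheckFoldModule 𝒱 ℳ) (a : V) : Dist K (Module.End K M) :=
  fun n => Y.prod n a

/-- `M` is bounded: `a(ž) c` is a vertex series for all `a ∈ V` and `c ∈ M`. -/
def CheckFoldModule.IsBounded (Y : CheckFoldModule 𝒱 ℳ) : Prop :=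
  ∀ (a : V) (c : M), IsVertexSeries (fun n => Y.prod n a c)

/-- An operator is even if it preserves the grading by parity. -/
def IsEvenOp (𝒱 : ZMod 2 → Submodule K V) (T : V →ₗ[K] V) : Prop :=
  ∀ p, ∀ a ∈ 𝒱 p, T a ∈ 𝒱 p

/-- The pair `(T, T')` of operators of `V` is a translation endomorphism of `M`:
`(T a)(ž) = ∂_z a(ž)` and `(T' a)(ž) = ∂_z̄ a(ž)` on `M`. -/
def IsTranslationEndomorphism (Y : CheckFoldModule 𝒱 ℳ) (T T' : V →ₗ[K] V) : Prop :=
  ∀ (a : V) (c : M) (n : K × K),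
    Y.prod n (T a) c = -(n.1 • Y.prod (n - (1, 0)) a c) ∧
    Y.prod n (T' a) c = -(n.2 • Y.prod (n - (0, 1)) a c)

/-- The divided power `T^i / i!`. -/
noncomputable def divPow (T : V →ₗ[K] V) (i : ℕ) : V →ₗ[K] V := ((i.factorial : K)⁻¹) • T ^ i

/-- States `a` and `b` of parities `p` and `q` satisfy skew-symmetry for `(T, T')`:
`a(ž) b` is a vertex series (with support in `Ǩ`) and for any `n ∈ Ǩ`
`(-1)^{pq} b_(n) a = ∑_{i ∈ ℕ²} (-1)^{n - n̄ + i + ī} T^{(i)} T'^{(ī)} (a_(n+i) b)`,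
a finite sum. -/
def SkewSymmetric (Y : CheckFoldAlgebra 𝒱) (T T' : V →ₗ[K] V) (p q : ZMod 2) (a b : V) : Prop :=
  IsVertexSeries (fun n => Y.prod n a b) ∧
  ∀ n ∈ checkK K, superSign K p q • Y.prod n b a =
    ∑ᶠ i : ℕ × ℕ, (checkSign n * (-1) ^ (i.1 + i.2)) •
      divPow T i.1 (divPow T' i.2 (Y.prod (n + natPair K i) a b))

/-- The distribution `a(x̌ + w̌) b(w̌) c` in `x̌, w̌`, where
`a(x̌ + w̌) = ∑_n a_(n) (x̌ + w̌)^{-n-1}` is expanded in nonnegative powers of `w̌`.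
Each mode is a finite sum if `b` is bounded on `c`. -/
noncomputable def shiftProd (YM : CheckFoldModule 𝒱 ℳ) (a b : V) (c : M) : Dist₂ K M :=
  fun n m => ∑ᶠ i : ℕ × ℕ,
    binom₂ (-(n - natPair K i) - 1) i • YM.prod (n - natPair K i) a (YM.prod (m + natPair K i) b c)

/-- The distribution `(a(x̌) b)(w̌) c` in `x̌, w̌`. -/
def iterProd (YV : CheckFoldAlgebra 𝒱) (YM : CheckFoldModule 𝒱 ℳ) (a b : V) (c : M) :
    Dist₂ K M :=
  fun n m => YM.prod m (YV.prod n a b) c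

/-- The vertex series `d^j(ž, w̌)` and the `k_j` form a dual OPE of `a, b, c`:
`a(x̌ + w̌) b(w̌) c = ∑_j d^j(x̌, w̌) / (x̌ + w̌)^{k_j}` and
`(a(x̌) b)(w̌) c = ∑_j d^j(x̌, w̌) / (w̌ + x̌)^{k_j}`. -/
def IsDualOPE (YV : CheckFoldAlgebra 𝒱) (YM : CheckFoldModule 𝒱 ℳ) (a b : V) (c : M)
    {s : ℕ} (k : Fin s → K × K) (d : Fin s → Dist₂ K M) : Prop :=
  (∀ j, IsVertexSeries₂ (d j)) ∧
  shiftProd YM a b c = ∑ j, mulPowFst 1 (-k j) (d j) ∧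
  iterProd YV YM a b c = ∑ j, mulPowSnd 1 (-k j) (d j)

/-- `a` and `b` are mutually dual on `c` of orders at most `h_1, …, h_r ∈ Ǩ` and of dual orders
at most `k_1, …, k_s ∈ Ǩ`: there is a dual OPE of `a, b, c` with dual pole orders `k_j` whose
numerators `d^j(ž, w̌)` are bounded in `ž` by `h_1, …, h_r`, i.e. bounded as distributions in `ž`
with values in the distributions in `w̌`. -/
def DualOn (YV : CheckFoldAlgebra 𝒱) (YM : CheckFoldModule 𝒱 ℳ) (a b : V) (c : M)
    {r s : ℕ} (h : Fin r → K × K) (k : Fin s → K × K) : Prop :=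
  (∀ i, h i ∈ checkK K) ∧ (∀ j, k j ∈ checkK K) ∧
  ∃ d : Fin s → Dist₂ K M, IsDualOPE YV YM a b c k d ∧ ∀ j, IsBoundedBy (d j) h

/-- `a` and `b` are mutually dual on `M` of orders at most `h_1, …, h_r`:
they are so on any vector of `M`, for some dual orders that may depend on the vector. -/
def DualOfOrdersAtMost (YV : CheckFoldAlgebra 𝒱) (YM : CheckFoldModule 𝒱 ℳ) (a b : V)
    {r : ℕ} (h : Fin r → K × K) : Prop :=
  ∀ c : M, ∃ (s : ℕ) (k : Fin s → K × K), DualOn YV YM a b c h k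

/-- `a` and `b` are dual on `M` with pole orders `h_1, …, h_r ∈ Ǩ`: the `h_i` are pairwise
incongruent modulo `ℤ²`, and for `n_1, …, n_r ∈ ℕ²` the states `a` and `b` are dual on `M` of
orders at most `h_1 - n_1, …, h_r - n_r` if and only if all `n_i` are zero. -/
def DualWithPoleOrders (YV : CheckFoldAlgebra 𝒱) (YM : CheckFoldModule 𝒱 ℳ) (a b : V)
    {r : ℕ} (h : Fin r → K × K) : Prop :=
  (∀ i, h i ∈ checkK K) ∧ (∀ i j, i ≠ j → ¬ IntCongr (h i) (h j)) ∧
  ∀ n : Fin r → ℕ × ℕ,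
    DualOfOrdersAtMost YV YM a b (fun i => h i - natPair K (n i)) ↔ ∀ i, n i = 0

end Fold

end OPEAlg

namespace OPEAlg

set_option linter.unusedSectionVars false

open Finset.HasAntidiagonal (antidiagonal)

/-! ### Binomial coefficients with arguments in the field. -/

section Binomial

variable {K : Type*} [Field K] [CharZero K]

/-! Put `z = x + w`. In a dual OPE of `a, b, c`, the terms of total degree `D` form one finite sum
of monomials `u^A v^B t^C`, `A + B + C = D`, in three variables of sum zero: `u = x`, `v = w`, `t =
-(x + w)`. Its expansion for `u > v` is `a(x + w) b(w) c`, and that for `v > u` is `(a(x) b)(w) c`.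
Duality on `c` is thus the existence of a suitable family of such sums (`IsRep`), and the orders
bound the exponents of `u` (`dualOfOrdersAtMost_iff`). Duality, skew-symmetry and locality become
permutations of the three variables.

Exchanging `u` and `t` keeps the expansion in powers of `v` and acts on series as the substitution
`u ↦ -(u + v)` (`triOp_shWt_expand`); it recovers `a(z) b(w) c` from `a(x + w) b(w) c`.
Skew-symmetry, with the translation operators acting as derivatives, says that exchanging `v` and
`t` turns the sums for `a, b` into sums with the expansion `(b(x) a)(w) c`, up to sign
(`IsRep.skew`). Duality of `b, a` then forces their other expansion to be `b(x + w) a(w) c`. So the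
same sums expand to `a(z) b(w) c` for `z > w` and to `b(w) a(z) c`, up to the supersign, for `w >
z`. Collecting the powers of `z - w` gives the OPE (`exists_ope_of_isRep`).

A sum is not unique, because `u + v + t = 0`. What makes the argument work is that one expansion
determines the other (`expand_swap₁₂_eq_zero`). The exponents are not integers, so there is no
common denominator to clear. Instead, the vanishing of an expansion says that a finite combination
of point evaluations, at the exponents of `t`, kills all binomial coefficients. By interpolation it
kills every function, in particular the coefficients of the other expansion.

For the pole orders, `t^N = (-(u + v))^N` allows the exponents of `t` to be moved down to fixed
representatives modulo `ℤ²`, without lowering exponents of `u`. After that a sum is determined by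
its expansion (`eq_zero_of_expand_eq_zero`). Hence two families of bounds hold for a common sum, and
pole orders are least among bounds (`DualWithPoleOrders.exists_eq_add`). The skew exchange fixes
`u`, so `a, b` and `b, a` have the same bounds and therefore the same pole orders. A factor `(z -
w)^n` of a numerator would lower the duality orders, so the OPE is reduced. -/

theorem binom_zero_right (a : K) : binom a 0 = 1 := by simp [binom]

theorem binom_succ_mul (a : K) (n : ℕ) :
    binom a (n + 1) * ((n : K) + 1) = binom a n * (a - n) := by
  have h1 : ((n + 1 : ℕ) : K) ≠ 0 := Nat.cast_ne_zero.2 n.succ_ne_zero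
  have h2 : (n.factorial : K) ≠ 0 := Nat.cast_ne_zero.2 n.factorial_ne_zero
  simp only [binom, Finset.prod_range_succ, Nat.factorial_succ, Nat.cast_mul]
  push_cast at h1 ⊢
  field_simp

theorem binom_eq_choose (a : K) (n : ℕ) : binom a n = Ring.choose a n := by
  rw [Ring.choose_eq_smul, binom, ← Polynomial.aeval_eq_smeval, ← Polynomial.eval_map_algebraMap,
    descPochhammer_map, descPochhammer_eval_eq_prod_range, smul_eq_mul, div_eq_inv_mul]

theorem binom_add (a b : K) (k : ℕ) :
    ∑ x ∈ antidiagonal k, binom a x.1 * binom b x.2 = binom (a + b) k := by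
  simp only [binom_eq_choose, Ring.add_choose_eq k (Commute.all a b)]

theorem binom_neg_sub_one (a : K) (n : ℕ) : binom (-a - 1) n = (-1) ^ n * binom (a + n) n := by
  have h : ∏ j ∈ Finset.range n, (-a - 1 - (j : K)) =
      (-1) ^ n * ∏ j ∈ Finset.range n, (a + n - (j : K)) := by
    rw [← Finset.prod_range_reflect, ← Finset.card_range n, ← Finset.prod_const,
      Finset.card_range, ← Finset.prod_mul_distrib]
    refine Finset.prod_congr rfl fun j hj => ?_
    have hj := Finset.mem_range.1 hj
    rw [Nat.cast_sub (by omega), Nat.cast_sub (by omega)]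
    push_cast
    ring
  rw [binom, binom, h, mul_div_assoc]

/-- This is the coefficient of `X^k` in `(1 + X)^(a + c) (1 - X / (1 + X))^c = (1 + X)^a`. It
encodes that `u ↦ -(u + v)` sends `u + v` to `-u`. Negating the upper arguments reduces it to
Vandermonde's identity. -/
theorem binom_shift (a c : K) (k : ℕ) :
    ∑ x ∈ antidiagonal k, (-1) ^ x.1 * binom c x.1 * binom (a + c - x.1) x.2 =
      binom a k := by
  have h : ∀ x ∈ antidiagonal k, (-1) ^ x.1 * binom c x.1 * binom (a + c - x.1) x.2 =
      (-1) ^ k * (binom c x.1 * binom (k - (a + c) - 1) x.2) := by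
    intro x hx
    have hx := Finset.HasAntidiagonal.mem_antidiagonal.1 hx
    have e : (k : K) - (a + c) - 1 = -(a + c - k) - 1 := by ring
    rw [e, binom_neg_sub_one, ← hx, pow_add]
    have e2 : a + c - ((x.1 + x.2 : ℕ) : K) + x.2 = a + c - x.1 := by push_cast; ring
    rw [e2]
    have : ((-1 : K) ^ x.2) * (-1) ^ x.2 = 1 := by rw [← mul_pow]; simp
    linear_combination (-((-1) ^ x.1 * binom c x.1 * binom (a + c - x.1) x.2)) * this
  rw [Finset.sum_congr rfl h, ← Finset.mul_sum, binom_add]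
  have e : c + ((k : K) - (a + c) - 1) = -(a - k) - 1 := by ring
  rw [e, binom_neg_sub_one, ← mul_assoc, ← mul_pow]
  simp

theorem binom_zero_left (n : ℕ) : binom (0 : K) n = if n = 0 then 1 else 0 := by
  cases n <;> simp [binom_eq_choose, Ring.choose_zero_succ]

theorem binom_natCast (n k : ℕ) : binom (n : K) k = (n.choose k : K) := by
  rw [binom_eq_choose, Ring.choose_natCast]

theorem binom_succ_succ (a : K) (n : ℕ) :
    binom (a + 1) (n + 1) = binom a n + binom a (n + 1) := by
  simp only [binom_eq_choose, Ring.choose_succ_succ]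

/-- The `N`-th finite difference of a binomial coefficient. -/
theorem sum_choose_mul_binom (c : K) (N i : ℕ) :
    ∑ x ∈ antidiagonal N, (-1) ^ x.2 * (N.choose x.1 : K) * binom (c + x.1) i =
      if N ≤ i then binom c (i - N) else 0 := by
  -- By Pascal's rule, one forward difference lowers the lower index by one.
  have key : ∀ (N : ℕ) (c : K) (i : ℕ), (fwdDiff (1 : K))^[N] (fun a => binom a i) c =
      if N ≤ i then binom c (i - N) else 0 := by
    intro N
    induction N with
    | zero => intro c i; simp
    | succ N ih =>
      intro c i
      rw [Function.iterate_succ_apply]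
      cases i with
      | zero =>
        have : fwdDiff (1 : K) (fun a => binom a 0) = fun _ => 0 := by
          funext a; simp [fwdDiff, binom_zero_right]
        rw [this]
        simp only [Nat.le_zero_eq, Nat.add_eq_zero_iff, one_ne_zero, and_false, if_false]
        have h0 : ∀ n, (fwdDiff (1 : K))^[n] (fun _ : K => (0 : K)) = fun _ => 0 := by
          intro n
          induction n with
          | zero => rfl
          | succ n ih => rw [Function.iterate_succ_apply', ih]; simp
        rw [h0]
      | succ i =>
        have : fwdDiff (1 : K) (fun a => binom a (i + 1)) = fun a => binom a i := by
          funext a; simp [fwdDiff, binom_succ_succ]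
        rw [this, ih]
        simp
  rw [← key, fwdDiff_iter_eq_sum_shift, Finset.Nat.antidiagonal_eq_map, Finset.sum_map]
  refine Finset.sum_congr rfl fun x hx => ?_
  change (-1) ^ (N - x) * (N.choose x : K) * binom (c + x) i = _
  simp [zsmul_eq_mul]

end Binomial

/-! ### The same identities for pairs, coordinate by coordinate. -/

section Pairs

/-- The pairs of elements of `ℕ²` with sum `k`. -/
def antidiag₂ (k : ℕ × ℕ) : Finset ((ℕ × ℕ) × (ℕ × ℕ)) :=
  (antidiagonal k.1 ×ˢ antidiagonal k.2).map (Equiv.prodProdProdComm ℕ ℕ ℕ ℕ).toEmbedding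

theorem mem_antidiag₂ {k : ℕ × ℕ} {x : (ℕ × ℕ) × (ℕ × ℕ)} :
    x ∈ antidiag₂ k ↔ x.1 + x.2 = k := by
  obtain ⟨⟨a, b⟩, c, d⟩ := x
  obtain ⟨k, l⟩ := k
  simp [antidiag₂, Equiv.prodProdProdComm, Finset.HasAntidiagonal.mem_antidiagonal]

theorem sum_antidiag₂ {R : Type*} [CommSemiring R] (k : ℕ × ℕ) (f g : ℕ × ℕ → R) :
    ∑ x ∈ antidiag₂ k, f (x.1.1, x.2.1) * g (x.1.2, x.2.2) =
      (∑ x ∈ antidiagonal k.1, f x) * ∑ x ∈ antidiagonal k.2, g x := by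
  rw [antidiag₂, Finset.sum_map, Finset.sum_product, Finset.sum_mul_sum]
  rfl

variable {K : Type*} [Field K] [CharZero K]

/-- The sign `(-1)^(i + ī)`. -/
def natSign (K : Type*) [Field K] (i : ℕ × ℕ) : K := (-1) ^ (i.1 + i.2)

theorem natSign_mul_self (i : ℕ × ℕ) : natSign K i * natSign K i = 1 := by
  rw [natSign, ← mul_pow]
  simp

theorem natPair_add (i j : ℕ × ℕ) : natPair K (i + j) = natPair K i + natPair K j := by
  simp [natPair]

theorem natPair_zero : natPair K (0 : ℕ × ℕ) = 0 := by simp [natPair, ← Prod.zero_eq_mk]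

theorem natPair_injective : Function.Injective (natPair K) := by
  rintro ⟨a, b⟩ ⟨c, d⟩ h
  simpa [natPair] using h

theorem binom₂_zero_right (a : K × K) : binom₂ a 0 = 1 := by simp [binom₂, binom_zero_right]

theorem binom₂_zero_left (i : ℕ × ℕ) : binom₂ (0 : K × K) i = if i = 0 then 1 else 0 := by
  obtain ⟨a, b⟩ := i
  simp only [binom₂, Prod.fst_zero, Prod.snd_zero, binom_zero_left, Prod.mk_eq_zero]
  split_ifs <;> simp_all

theorem binom₂_add (a b : K × K) (k : ℕ × ℕ) :
    ∑ x ∈ antidiag₂ k, binom₂ a x.1 * binom₂ b x.2 = binom₂ (a + b) k := by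
  rw [binom₂, Prod.fst_add, Prod.snd_add, ← binom_add, ← binom_add, ← sum_antidiag₂]
  refine Finset.sum_congr rfl fun x _ => ?_
  simp only [binom₂]
  ring

theorem binom₂_neg_sub_one (a : K × K) (n : ℕ × ℕ) :
    binom₂ (-a - 1) n = natSign K n * binom₂ (a + natPair K n) n := by
  simp only [binom₂, natSign, natPair, pow_add, Prod.fst_sub, Prod.snd_sub, Prod.fst_neg,
    Prod.snd_neg, Prod.fst_one, Prod.snd_one, binom_neg_sub_one, Prod.fst_add, Prod.snd_add]
  ring

theorem binom₂_shift (a c : K × K) (k : ℕ × ℕ) :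
    ∑ x ∈ antidiag₂ k, natSign K x.1 * binom₂ c x.1 * binom₂ (a + c - natPair K x.1) x.2 =
      binom₂ a k := by
  rw [binom₂, ← binom_shift a.1 c.1, ← binom_shift a.2 c.2, ← sum_antidiag₂]
  refine Finset.sum_congr rfl fun x _ => ?_
  simp only [binom₂, natSign, natPair, pow_add, Prod.fst_sub, Prod.snd_sub, Prod.fst_add,
    Prod.snd_add]
  ring

theorem binom₂_natPair_eq_zero {N l : ℕ × ℕ} (h : ¬ l ≤ N) : binom₂ (natPair K N) l = 0 := by
  simp only [binom₂, natPair, binom_natCast]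
  rw [Prod.le_def, not_and_or, not_le, not_le] at h
  rcases h with h | h <;> simp [Nat.choose_eq_zero_of_lt h]

theorem binom₂_natPair_symm (i j : ℕ × ℕ) :
    binom₂ (natPair K (i + j)) i = binom₂ (natPair K (i + j)) j := by
  simp only [binom₂, natPair, binom_natCast, Prod.fst_add, Prod.snd_add]
  rw [Nat.choose_symm_add, Nat.choose_symm_add]

/-- Multiply `v^N = ((u + v) - u)^N` by `(u + v)^c` and compare powers of `v`. A shifted binomial
coefficient thus becomes a combination of values, at translates of `c`, of the unshifted one. -/
theorem sum_binom₂_mul_binom₂ (c : K × K) (N i : ℕ × ℕ) :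
    ∑ x ∈ antidiag₂ N, natSign K x.2 * binom₂ (natPair K N) x.1 * binom₂ (c + natPair K x.1) i =
      if N ≤ i then binom₂ c (i - N) else 0 := by
  have h := sum_antidiag₂ N
    (fun x => (-1) ^ x.2 * (N.1.choose x.1 : K) * binom (c.1 + x.1) i.1)
    (fun x => (-1) ^ x.2 * (N.2.choose x.1 : K) * binom (c.2 + x.1) i.2)
  rw [sum_choose_mul_binom, sum_choose_mul_binom] at h
  have e : (if N ≤ i then binom₂ c (i - N) else 0) =
      (if N.1 ≤ i.1 then binom c.1 (i.1 - N.1) else 0) *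
        if N.2 ≤ i.2 then binom c.2 (i.2 - N.2) else 0 := by
    simp only [Prod.le_def, binom₂, Prod.fst_sub, Prod.snd_sub]
    split_ifs <;> simp_all
  rw [e, ← h]
  refine Finset.sum_congr rfl fun x _ => ?_
  simp only [binom₂, natSign, natPair, pow_add, binom_natCast, Prod.fst_add, Prod.snd_add]
  ring

end Pairs

/-! ### Point evaluations that annihilate binomial coefficients. -/

section Interpolation

variable {K M ι : Type*} [Field K] [CharZero K] [AddCommGroup M] [Module K M]

/-- The span is stable under multiplication by `x`, since `x * binom x n = (n + 1) * binom x (n + 1)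
+ n * binom x n`. -/
theorem eval_mem_span_binom (p : Polynomial K) :
    (fun x => p.eval x) ∈ Submodule.span K (Set.range fun (n : ℕ) (x : K) => binom x n) := by
  have hmul : ∀ f ∈ Submodule.span K (Set.range fun (n : ℕ) (x : K) => binom x n),
      (fun x => x * f x) ∈ Submodule.span K (Set.range fun (n : ℕ) (x : K) => binom x n) := by
    intro f hf
    induction hf using Submodule.span_induction with
    | mem f hf =>
      obtain ⟨n, rfl⟩ := hf
      have : (fun x : K => x * binom x n) =
          ((n : K) + 1) • (fun x => binom x (n + 1)) + (n : K) • fun x => binom x n := by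
        funext x
        have := binom_succ_mul x n
        simp only [Pi.add_apply, Pi.smul_apply, smul_eq_mul]
        linear_combination -this
      rw [this]
      exact add_mem (Submodule.smul_mem _ _ (Submodule.subset_span ⟨_, rfl⟩))
        (Submodule.smul_mem _ _ (Submodule.subset_span ⟨_, rfl⟩))
    | zero => simp only [Pi.zero_apply, mul_zero]; exact zero_mem _
    | add f g _ _ hf hg => simp only [Pi.add_apply, mul_add]; exact add_mem hf hg
    | smul a f _ hf =>
      have := Submodule.smul_mem _ a hf
      convert this using 1
      funext x
      simp only [Pi.smul_apply, smul_eq_mul]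
      ring
  induction p using Polynomial.induction_on' with
  | add p q hp hq => simp only [Polynomial.eval_add]; exact add_mem hp hq
  | monomial n a =>
    have h : ∀ n : ℕ, (fun x : K => x ^ n) ∈
        Submodule.span K (Set.range fun (n : ℕ) (x : K) => binom x n) := by
      intro n
      induction n with
      | zero =>
        refine Submodule.subset_span ⟨0, ?_⟩
        funext x
        simp [binom_zero_right]
      | succ n ih => simpa only [pow_succ'] using hmul _ ih
    simp only [Polynomial.eval_monomial]
    exact Submodule.smul_mem _ a (h n)

/-- A finite combination of point evaluations on `K²` that vanishes on all the binomial
coefficients vanishes on all functions. -/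
theorem sum_smul_eq_zero_of_binom₂ (s : Finset ι) (β : ι → K × K) (m : ι → M)
    (h : ∀ i, ∑ t ∈ s, binom₂ (β t) i • m t = 0) (φ : K × K → K) :
    ∑ t ∈ s, φ (β t) • m t = 0 := by
  classical
  have h1 : ∀ f ∈ Submodule.span K (Set.range fun (n : ℕ) (x : K) => binom x n), ∀ j,
      ∑ t ∈ s, (f (β t).1 * binom (β t).2 j) • m t = 0 := by
    intro f hf j
    induction hf using Submodule.span_induction with
    | mem f hf => obtain ⟨n, rfl⟩ := hf; exact h (n, j)
    | zero => simp
    | add f g _ _ hf hg =>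
      simp only [Pi.add_apply, add_mul, add_smul, Finset.sum_add_distrib, hf, hg, add_zero]
    | smul a f _ hf =>
      simp only [Pi.smul_apply, smul_eq_mul, mul_assoc, mul_smul a, ← Finset.smul_sum, hf,
        smul_zero]
  have h2 : ∀ f ∈ Submodule.span K (Set.range fun (n : ℕ) (x : K) => binom x n),
      ∀ g ∈ Submodule.span K (Set.range fun (n : ℕ) (x : K) => binom x n),
      ∑ t ∈ s, (f (β t).1 * g (β t).2) • m t = 0 := by
    intro f hf g hg
    induction hg using Submodule.span_induction with
    | mem g hg => obtain ⟨n, rfl⟩ := hg; exact h1 f hf n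
    | zero => simp
    | add g g' _ _ hg hg' =>
      simp only [Pi.add_apply, mul_add, add_smul, Finset.sum_add_distrib, hg, hg', add_zero]
    | smul a g _ hg =>
      simp only [Pi.smul_apply, smul_eq_mul, mul_left_comm _ a, mul_smul a, ← Finset.smul_sum, hg,
        smul_zero]
  let S := s.image fun t => (β t).1
  let S' := s.image fun t => (β t).2
  -- On the finite grid `S × S'`, which contains all the points, `φ` agrees with its Lagrange
  -- interpolation, a combination of products of one-variable polynomials.
  have key : ∀ t ∈ s, φ (β t) = ∑ u ∈ S, ∑ v ∈ S', φ (u, v) *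
      ((Lagrange.basis S id u).eval (β t).1 * (Lagrange.basis S' id v).eval (β t).2) := by
    intro t ht
    have hu : (β t).1 ∈ S := Finset.mem_image_of_mem _ ht
    have hv : (β t).2 ∈ S' := Finset.mem_image_of_mem _ ht
    rw [Finset.sum_eq_single_of_mem _ hu, Finset.sum_eq_single_of_mem _ hv]
    · have e1 := Lagrange.eval_basis_self (v := id) (Set.injOn_id _) hu
      have e2 := Lagrange.eval_basis_self (v := id) (Set.injOn_id _) hv
      simp only [id] at e1 e2
      rw [e1, e2]
      simp
    · intro v hv' hne
      have := Lagrange.eval_basis_of_ne (v := id) hne hv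
      simp only [id] at this
      rw [this]
      simp
    · intro u hu' hne
      have := Lagrange.eval_basis_of_ne (v := id) hne hu
      simp only [id] at this
      simp [this]
  rw [Finset.sum_congr rfl fun t ht => by rw [key t ht]]
  simp only [Finset.sum_smul]
  rw [Finset.sum_comm]
  refine Finset.sum_eq_zero fun u _ => ?_
  rw [Finset.sum_comm]
  refine Finset.sum_eq_zero fun v _ => ?_
  simp only [mul_smul (φ (u, v)), ← Finset.smul_sum]
  rw [h2 _ (eval_mem_span_binom _) _ (eval_mem_span_binom _), smul_zero]

end Interpolation

/-! ### The exponent group, its sign character, and binomial coefficients extended by zero. -/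

section Lattice

variable (K : Type*) [Field K]

/-- The subgroup `Ǩ` of `K²`. -/
def Lat : AddSubgroup (K × K) where
  carrier := checkK K
  zero_mem' := ⟨0, by simp⟩
  add_mem' := by
    rintro a b ⟨m, hm⟩ ⟨n, hn⟩
    refine ⟨m + n, ?_⟩
    push_cast
    rw [← hm, ← hn, Prod.fst_add, Prod.snd_add]
    ring
  neg_mem' := by
    rintro a ⟨m, hm⟩
    refine ⟨-m, ?_⟩
    push_cast
    rw [← hm, Prod.fst_neg, Prod.snd_neg]
    ring

variable {K}

theorem natPair_mem_lat (i : ℕ × ℕ) : natPair K i ∈ Lat K :=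
  ⟨(i.1 : ℤ) - i.2, by simp [natPair]⟩

theorem one_mem_lat : (1 : K × K) ∈ Lat K := ⟨0, by simp⟩

/-- The inclusion of `ℕ²` in `Ǩ`. -/
def latNat (K : Type*) [Field K] : ℕ × ℕ →+ Lat K where
  toFun i := ⟨natPair K i, natPair_mem_lat i⟩
  map_zero' := by ext <;> simp [natPair]
  map_add' _ _ := by ext <;> simp [natPair]

@[simp] theorem coe_latNat (i : ℕ × ℕ) : (latNat K i : K × K) = natPair K i := rfl

variable (K) in
/-- The pair `(1, 1)` as an element of `Ǩ`. -/
def latOne : Lat K := ⟨1, one_mem_lat⟩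

@[simp] theorem coe_latOne : (latOne K : K × K) = 1 := rfl

variable [CharZero K]

theorem latNat_injective : Function.Injective (latNat K) := fun _ _ h =>
  natPair_injective (K := K) (congrArg Subtype.val h)

theorem checkSign_eq {h : K × K} {m : ℤ} (hm : h.1 - h.2 = (m : K)) :
    checkSign h = (-1) ^ m := by
  have : (∃ m : ℤ, Even m ∧ h.1 - h.2 = (m : K)) ↔ Even m := by
    constructor
    · rintro ⟨n, hn, e⟩
      rw [hm, Int.cast_inj] at e
      rwa [e]
    · intro he
      exact ⟨m, he, hm⟩
  rw [checkSign]
  simp only [this]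
  split_ifs with he
  · exact he.neg_one_zpow.symm
  · exact (Int.not_even_iff_odd.1 he).neg_one_zpow.symm

/-- The sign character of `Ǩ`. -/
noncomputable def sg (h : Lat K) : K := checkSign (h : K × K)

theorem sg_add (h h' : Lat K) : sg (h + h') = sg h * sg h' := by
  obtain ⟨m, hm⟩ := h.2
  obtain ⟨n, hn⟩ := h'.2
  have : ((h + h' : Lat K) : K × K).1 - ((h + h' : Lat K) : K × K).2 = ((m + n : ℤ) : K) := by
    push_cast
    rw [← hm, ← hn, Prod.fst_add, Prod.snd_add]
    ring
  rw [sg, sg, sg, checkSign_eq hm, checkSign_eq hn, checkSign_eq this, zpow_add₀ (by simp)]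

theorem sg_mul_self (h : Lat K) : sg h * sg h = 1 := by
  obtain ⟨m, hm⟩ := h.2
  rw [sg, checkSign_eq hm, ← mul_zpow]
  simp

theorem sg_ne_zero (h : Lat K) : sg h ≠ 0 := left_ne_zero_of_mul_eq_one (sg_mul_self h)

theorem sg_zero : sg (0 : Lat K) = 1 := by
  have := sg_add (0 : Lat K) 0
  rw [add_zero, sg_mul_self] at this
  exact this

theorem sg_neg (h : Lat K) : sg (-h) = sg h := by
  have := sg_add h (-h)
  rw [add_neg_cancel, sg_zero, ← sg_mul_self h] at this
  exact (mul_left_cancel₀ (sg_ne_zero h) this).symm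

theorem sg_sub (h h' : Lat K) : sg (h - h') = sg h * sg h' := by
  rw [sub_eq_add_neg, sg_add, sg_neg]

theorem sg_latNat (i : ℕ × ℕ) : sg (latNat K i) = natSign K i := by
  have : ((latNat K i : Lat K) : K × K).1 - ((latNat K i : Lat K) : K × K).2 =
      (((i.1 : ℤ) - i.2 : ℤ) : K) := by simp [natPair]
  rw [sg, checkSign_eq this, natSign, zpow_sub₀ (by simp), pow_add, zpow_natCast, zpow_natCast,
    div_eq_mul_inv]
  congr 1
  rw [← inv_pow]
  simp

theorem sg_latOne : sg (latOne K) = 1 := by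
  have : ((latOne K : Lat K) : K × K).1 - ((latOne K : Lat K) : K × K).2 = ((0 : ℤ) : K) := by
    simp
  rw [sg, checkSign_eq this, zpow_zero]

/-- The binomial coefficient extended by zero from `ℕ²` to `Ǩ`. -/
noncomputable def extBinom (c e : Lat K) : K :=
  Function.extend (latNat K) (fun i => binom₂ (c : K × K) i) 0 e

theorem extBinom_latNat (c : Lat K) (i : ℕ × ℕ) : extBinom c (latNat K i) = binom₂ (c : K × K) i :=
  latNat_injective.extend_apply _ _ _

theorem extBinom_eq_zero {c e : Lat K} (h : ∀ i, latNat K i ≠ e) : extBinom c e = 0 :=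
  Function.extend_apply' _ _ _ (fun ⟨i, hi⟩ => h i hi)

end Lattice

/-! ### Triangular operators: multiplication by powers of a sum and the substitution `u ↦ -(u + v)`.
-/

section Operators

variable {K M : Type*} [Field K] [CharZero K] [AddCommGroup M] [Module K M]

/-- The triangular operator on functions on `Ǩ` with matrix entries `w i B` at `(B + i, B)`,
`i ∈ ℕ²`. -/
noncomputable def triOp (w : ℕ × ℕ → Lat K → K) (g : Lat K → M) : Lat K → M :=
  fun Q => ∑ᶠ i, w i (Q - latNat K i) • g (Q - latNat K i)

/-- A function on `Ǩ` is bounded below if it has finitely many nonzero values on each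
`Q - ℕ²`. -/
def BddBelowOn (g : Lat K → M) : Prop := ∀ Q, {i | g (Q - latNat K i) ≠ 0}.Finite

theorem sum_antidiag₂_swap {N : Type*} [AddCommMonoid N] (k : ℕ × ℕ)
    (f : (ℕ × ℕ) × (ℕ × ℕ) → N) : ∑ x ∈ antidiag₂ k, f x.swap = ∑ x ∈ antidiag₂ k, f x := by
  refine Finset.sum_nbij' Prod.swap Prod.swap ?_ ?_ ?_ ?_ ?_ <;>
    simp [mem_antidiag₂, add_comm]

/-- Operators compose by convolving their weights. Boundedness below makes the double sum finite, so
that it may be regrouped by total shift. -/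
theorem triOp_comp {w₁ w₂ w₃ : ℕ × ℕ → Lat K → K} {g : Lat K → M} (hg : BddBelowOn g)
    (h : ∀ k B, ∑ x ∈ antidiag₂ k, w₁ x.1 B * w₂ x.2 (B + latNat K x.1) = w₃ k B) :
    triOp w₂ (triOp w₁ g) = triOp w₃ g := by
  classical
  funext Q
  have hI := hg Q
  set I := hI.toFinset with hIdef
  have hmem : ∀ k, k ∈ I ↔ g (Q - latNat K k) ≠ 0 := by simp [hIdef]
  let F : (ℕ × ℕ) × (ℕ × ℕ) → M := fun x =>
    w₂ x.1 (Q - latNat K x.1) • w₁ x.2 (Q - latNat K x.1 - latNat K x.2) •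
      g (Q - latNat K x.1 - latNat K x.2)
  have hsupp : Function.support F ⊆ ↑(I.biUnion antidiag₂) := by
    intro x hx
    rw [Finset.mem_coe, Finset.mem_biUnion]
    refine ⟨x.1 + x.2, ?_, mem_antidiag₂.2 rfl⟩
    rw [hmem, map_add, ← sub_sub]
    intro h0
    exact hx (by simp only [F, h0, smul_zero])
  have h1 : triOp w₂ (triOp w₁ g) Q = ∑ᶠ x, F x := by
    rw [finsum_curry F ((I.biUnion antidiag₂).finite_toSet.subset hsupp)]
    refine finsum_congr fun j => ?_
    rw [triOp, smul_finsum]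
  have h2 : triOp w₃ g Q = ∑ k ∈ I, w₃ k (Q - latNat K k) • g (Q - latNat K k) := by
    rw [triOp]
    refine finsum_eq_sum_of_support_subset _ fun k hk => ?_
    rw [Finset.mem_coe, hmem]
    intro h0
    exact hk (by simp only [h0, smul_zero])
  rw [h1, h2, finsum_eq_sum_of_support_subset _ hsupp, Finset.sum_biUnion]
  · refine Finset.sum_congr rfl fun k _ => ?_
    rw [← h, Finset.sum_smul, ← sum_antidiag₂_swap]
    refine Finset.sum_congr rfl fun x hx => ?_
    have hx := mem_antidiag₂.1 hx
    have e1 : Q - latNat K x.2 - latNat K x.1 = Q - latNat K k := by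
      rw [← hx, map_add]; abel
    have e2 : Q - latNat K x.2 = Q - latNat K k + latNat K x.1 := by
      rw [← hx, map_add]; abel
    simp only [F, Prod.fst_swap, Prod.snd_swap, e1, smul_smul]
    rw [e2, mul_comm]
  · intro k _ l _ hkl
    rw [Function.onFun, Finset.disjoint_left]
    intro x hx hx'
    exact hkl ((mem_antidiag₂.1 hx).symm.trans (mem_antidiag₂.1 hx'))

theorem triOp_sum {ι : Type*} {s : Finset ι} {g : ι → Lat K → M} (w : ℕ × ℕ → Lat K → K)
    (h : ∀ t ∈ s, BddBelowOn (g t)) :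
    triOp w (fun Q => ∑ t ∈ s, g t Q) = fun Q => ∑ t ∈ s, triOp w (g t) Q := by
  funext Q
  simp only [triOp, Finset.smul_sum]
  refine finsum_sum_comm s _ fun t ht => ?_
  exact (h t ht Q).subset fun i hi h' => hi (by simp only [h', smul_zero])

theorem triOp_smul (w : ℕ × ℕ → Lat K → K) (a : K) (g : Lat K → M) :
    triOp w (fun Q => a • g Q) = fun Q => a • triOp w g Q := by
  funext Q
  simp only [triOp, smul_finsum]
  exact finsum_congr fun i => smul_comm _ _ _

open Classical in
/-- The function on `Ǩ` with value `m` at `B` and zero elsewhere. -/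
noncomputable def atom (B : Lat K) (m : M) : Lat K → M := fun Q => if Q = B then m else 0

theorem atom_self (B : Lat K) (m : M) : atom B m B = m := if_pos rfl

theorem atom_of_ne {B Q : Lat K} (h : Q ≠ B) (m : M) : atom B m Q = 0 := if_neg h

theorem bddBelowOn_atom (B : Lat K) (m : M) : BddBelowOn (atom B m) := by
  intro Q
  refine Set.Subsingleton.finite fun i hi j hj => ?_
  have : ∀ i, atom B m (Q - latNat K i) ≠ 0 → Q - latNat K i = B := by
    intro i hi
    by_contra h
    exact hi (atom_of_ne h m)
  have h := (this i hi).trans (this j hj).symm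
  exact latNat_injective (sub_right_injective h)

theorem triOp_atom_latNat (w : ℕ × ℕ → Lat K → K) (B : Lat K) (m : M) (i : ℕ × ℕ) :
    triOp w (atom B m) (B + latNat K i) = w i B • m := by
  rw [triOp, finsum_eq_single _ i]
  · rw [add_sub_cancel_right, atom_self]
  · intro j hj
    rw [atom_of_ne, smul_zero]
    intro h
    exact hj (latNat_injective (add_left_cancel (sub_eq_iff_eq_add.1 h).symm))

theorem triOp_atom_eq_zero (w : ℕ × ℕ → Lat K → K) {B Q : Lat K} (m : M)
    (h : ∀ i, B + latNat K i ≠ Q) : triOp w (atom B m) Q = 0 := by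
  rw [triOp]
  refine finsum_eq_zero_of_forall_eq_zero fun i => ?_
  rw [atom_of_ne, smul_zero]
  intro h'
  exact h i (by rw [← h']; abel)

/-- Multiplication by the `c`-th power of a sum. -/
noncomputable def mulWt (c : Lat K) : ℕ × ℕ → Lat K → K := fun i _ => binom₂ (c : K × K) i

/-- Substitution of the negative of a sum in a series of degree `D`. -/
noncomputable def shWt (D : Lat K) : ℕ × ℕ → Lat K → K :=
  fun i B => sg (D - B) * binom₂ ((D - B : Lat K) : K × K) i

theorem triOp_mulWt_atom (c B : Lat K) (m : M) (Q : Lat K) :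
    triOp (mulWt c) (atom B m) Q = extBinom c (Q - B) • m := by
  by_cases h : ∃ i, B + latNat K i = Q
  · obtain ⟨i, rfl⟩ := h
    rw [triOp_atom_latNat, add_sub_cancel_left, extBinom_latNat, mulWt]
  · push Not at h
    rw [triOp_atom_eq_zero _ _ h, extBinom_eq_zero, zero_smul]
    intro i hi
    exact h i (by rw [hi]; abel)

theorem triOp_mulWt_mulWt {g : Lat K → M} (hg : BddBelowOn g) (a c : Lat K) :
    triOp (mulWt a) (triOp (mulWt c) g) = triOp (mulWt (a + c)) g := by
  refine triOp_comp hg fun k B => ?_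
  simp only [mulWt]
  rw [binom₂_add, add_comm a c]
  rfl

theorem triOp_mulWt_zero (g : Lat K → M) : triOp (mulWt 0) g = g := by
  funext Q
  rw [triOp, finsum_eq_single _ 0]
  · simp [mulWt, binom₂_zero_right]
  · intro i hi
    simp [mulWt, binom₂_zero_left, hi]

/-- The substitution sends `(u + v)^c` to `(-u)^c`. Coefficients are indexed by the exponent of `v`,
so the factor `u^c` shows only in the degree, `D - c` instead of `D`, and in the sign. -/
theorem triOp_shWt_mulWt {g : Lat K → M} (hg : BddBelowOn g) (D c : Lat K) :
    triOp (shWt D) (triOp (mulWt c) g) = fun Q => sg c • triOp (shWt (D - c)) g Q := by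
  have : (fun Q => sg c • triOp (shWt (D - c)) g Q) =
      triOp (fun i B => sg c * shWt (D - c) i B) g := by
    funext Q
    simp only [triOp, smul_finsum, mul_smul]
  rw [this]
  refine triOp_comp hg fun k B => ?_
  simp only [mulWt, shWt]
  rw [← binom₂_shift _ (c : K × K), Finset.mul_sum, Finset.mul_sum]
  refine Finset.sum_congr rfl fun x _ => ?_
  have e : ((D - (B + latNat K x.1) : Lat K) : K × K) =
      ((D - c - B : Lat K) : K × K) + c - natPair K x.1 := by
    push_cast
    rw [coe_latNat]
    abel
  rw [e]
  have e2 : sg (D - (B + latNat K x.1)) = sg c * sg (D - c - B) * natSign K x.1 := by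
    simp only [sg_sub, sg_add, sg_latNat]
    linear_combination (-(sg D * sg B * natSign K x.1)) * sg_mul_self c
  rw [e2]
  ring

/-- The substitution `u ↦ -(u + v)` with `v` fixed is an involution. -/
theorem triOp_shWt_shWt {g : Lat K → M} (hg : BddBelowOn g) (D : Lat K) :
    triOp (shWt D) (triOp (shWt D) g) = g := by
  rw [triOp_comp (w₃ := mulWt 0) hg, triOp_mulWt_zero]
  intro k B
  simp only [mulWt, shWt]
  have h0 := binom₂_shift (0 : K × K) ((D - B : Lat K) : K × K) k
  have : ((0 : Lat K) : K × K) = 0 := rfl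
  rw [this, ← h0]
  refine Finset.sum_congr rfl fun x _ => ?_
  have e : ((D - (B + latNat K x.1) : Lat K) : K × K) =
      0 + ((D - B : Lat K) : K × K) - natPair K x.1 := by
    push_cast
    rw [coe_latNat]
    abel
  rw [e]
  have e2 : sg (D - B) * sg (D - (B + latNat K x.1)) = natSign K x.1 := by
    rw [← sub_sub, sg_sub (D - B), sg_latNat, ← mul_assoc, sg_mul_self, one_mul]
  linear_combination (binom₂ ((D - B : Lat K) : K × K) x.1 *
    binom₂ (0 + ((D - B : Lat K) : K × K) - natPair K x.1) x.2) * e2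

end Operators

/-! ### Binomial identities on the exponent group and representatives modulo `ℤ²`. -/

section ExtBinom

variable {K : Type*} [Field K] [CharZero K]

theorem latNat_sub_eq_iff {i j k : ℕ × ℕ} :
    latNat K i - latNat K j = latNat K k ↔ i = k + j := by
  rw [sub_eq_iff_eq_add, ← map_add, latNat_injective.eq_iff]

theorem extBinom_latNat_sub (c : Lat K) (i N : ℕ × ℕ) :
    extBinom c (latNat K i - latNat K N) =
      if N ≤ i then binom₂ (c : K × K) (i - N) else 0 := by
  split_ifs with h
  · rw [← extBinom_latNat]
    congr 1
    rw [latNat_sub_eq_iff, tsub_add_cancel_of_le h]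
  · refine extBinom_eq_zero fun k hk => h ?_
    rw [latNat_sub_eq_iff.1 hk.symm]
    exact le_add_self

theorem sum_antidiag₂_snd {N : Type*} [AddCommMonoid N] (k : ℕ × ℕ) (f : ℕ × ℕ → N) :
    ∑ x ∈ antidiag₂ k, f x.2 = ∑ j ∈ Finset.Iic k, f j := by
  refine Finset.sum_nbij' (fun x => x.2) (fun j => (k - j, j)) ?_ ?_ ?_ ?_ ?_
  · intro x hx
    rw [Finset.mem_Iic, ← mem_antidiag₂.1 hx]
    exact le_add_self
  · intro j hj
    rw [mem_antidiag₂]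
    exact tsub_add_cancel_of_le (Finset.mem_Iic.1 hj)
  · rintro ⟨x, y⟩ hx
    have hx := mem_antidiag₂.1 hx
    simp only [Prod.mk.injEq, and_true]
    rw [← hx]
    exact add_tsub_cancel_right _ _
  · intro j _
    rfl
  · intro x _
    rfl

/-- Used to pass from a sum over decompositions of the collapsed power `N` to one over
decompositions of the exponent `k`, where the convolution identities apply. -/
theorem sum_Iic_eq_sum_Iic {R : Type*} [AddCommMonoid R] (N k : ℕ × ℕ) (f : ℕ × ℕ → R)
    (h : ∀ j, f j ≠ 0 → j ≤ N ∧ j ≤ k) : ∑ j ∈ Finset.Iic N, f j = ∑ j ∈ Finset.Iic k, f j := by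
  rw [← finsum_eq_sum_of_support_subset (s := Finset.Iic N) f fun j hj => by
      simpa using (h j hj).1,
    ← finsum_eq_sum_of_support_subset (s := Finset.Iic k) f fun j hj => by
      simpa using (h j hj).2]

theorem extBinom_sub_latNat_eq_zero {c e : Lat K} (h : ∀ i, latNat K i ≠ e) (j : ℕ × ℕ) :
    extBinom c (e - latNat K j) = 0 := by
  refine extBinom_eq_zero fun i hi => h (i + j) ?_
  rw [map_add, hi, sub_add_cancel]

/-- Coefficient comparison in `(u + v)^c (u + v)^N = (u + v)^(c + N)`, expanded in powers of `v`. -/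
theorem sum_binom₂_mul_extBinom (c e : Lat K) (N : ℕ × ℕ) :
    ∑ x ∈ antidiag₂ N, binom₂ (natPair K N) x.2 * extBinom c (e - latNat K x.2) =
      extBinom (c + latNat K N) e := by
  by_cases h : ∃ k, latNat K k = e
  · obtain ⟨k, rfl⟩ := h
    rw [sum_antidiag₂_snd N
        (fun j => binom₂ (natPair K N) j * extBinom c (latNat K k - latNat K j)),
      sum_Iic_eq_sum_Iic N k, ← sum_antidiag₂_snd k
        (fun j => binom₂ (natPair K N) j * extBinom c (latNat K k - latNat K j)),
      extBinom_latNat, AddSubgroup.coe_add, coe_latNat, ← binom₂_add]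
    · refine Finset.sum_congr rfl fun x hx => ?_
      have hx := mem_antidiag₂.1 hx
      rw [latNat_sub_eq_iff.2 hx.symm, extBinom_latNat, mul_comm]
    · intro j hj
      constructor
      · by_contra hj'
        exact hj (by rw [binom₂_natPair_eq_zero hj', zero_mul])
      · by_contra hj'
        exact hj (by rw [extBinom_latNat_sub, if_neg hj', mul_zero])
  · push Not at h
    rw [extBinom_eq_zero h]
    exact Finset.sum_eq_zero fun x _ => by rw [extBinom_sub_latNat_eq_zero h, mul_zero]

/-- The identity `(u + v)^c ((u + v) - u)^N = (u + v)^c v^N`, now compared by powers of `u`. It is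
the counterpart, in the opposite domain, of `sum_binom₂_mul_binom₂`. -/
theorem sum_natSign_mul_extBinom (c e : Lat K) (N : ℕ × ℕ) :
    ∑ x ∈ antidiag₂ N, natSign K x.2 * binom₂ (natPair K N) x.1 *
      extBinom (c + latNat K x.1) (e - latNat K x.2) = extBinom c e := by
  by_cases h : ∃ k, latNat K k = e
  · obtain ⟨k, rfl⟩ := h
    let f : ℕ × ℕ → K := fun j => natSign K j * binom₂ (natPair K N) j *
      extBinom (c + latNat K N - latNat K j) (latNat K k - latNat K j)
    have h1 : ∑ x ∈ antidiag₂ N, natSign K x.2 * binom₂ (natPair K N) x.1 *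
      extBinom (c + latNat K x.1) (latNat K k - latNat K x.2) = ∑ x ∈ antidiag₂ N, f x.2 := by
      refine Finset.sum_congr rfl fun x hx => ?_
      have hx := mem_antidiag₂.1 hx
      have e : c + latNat K N - latNat K x.2 = c + latNat K x.1 := by
        rw [← hx, map_add]; abel
      simp only [f]
      rw [e, ← hx, binom₂_natPair_symm]
    rw [h1, sum_antidiag₂_snd, sum_Iic_eq_sum_Iic N k, ← sum_antidiag₂_snd, extBinom_latNat,
      ← binom₂_shift _ (natPair K N), ← sum_antidiag₂_swap]
    · refine Finset.sum_congr rfl fun x hx => ?_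
      have hx := mem_antidiag₂.1 hx
      simp only [f, Prod.snd_swap]
      rw [latNat_sub_eq_iff.2 (by rw [← hx, add_comm] : k = x.2 + x.1), extBinom_latNat]
      rfl
    · intro j hj
      constructor
      · by_contra hj'
        exact hj (by simp only [f]; rw [binom₂_natPair_eq_zero hj', mul_zero, zero_mul])
      · by_contra hj'
        exact hj (by simp only [f]; rw [extBinom_latNat_sub, if_neg hj', mul_zero])
  · push Not at h
    rw [extBinom_eq_zero h]
    exact Finset.sum_eq_zero fun x _ => by rw [extBinom_sub_latNat_eq_zero h, mul_zero]

variable (K) in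
/-- The subgroup `ℤ²` of `Ǩ`. -/
def intLat : AddSubgroup (Lat K) where
  carrier := {a | ∃ i j, a = latNat K i - latNat K j}
  zero_mem' := ⟨0, 0, by simp⟩
  add_mem' := by
    rintro _ _ ⟨i, j, rfl⟩ ⟨k, l, rfl⟩
    exact ⟨i + k, j + l, by simp only [map_add]; abel⟩
  neg_mem' := by
    rintro _ ⟨i, j, rfl⟩
    exact ⟨j, i, by abel⟩

theorem latNat_mem_intLat (i : ℕ × ℕ) : latNat K i ∈ intLat K := ⟨i, 0, by simp⟩

/-- A choice of representatives modulo `ℤ²` that lie below the elements of a finite set. -/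
theorem exists_lower_representatives (S : Finset (Lat K)) : ∃ ρ : Lat K → Lat K,
    (∀ a ∈ S, ∃ N, a = ρ a + latNat K N) ∧ (∀ a b, a - b ∈ intLat K → ρ a = ρ b) ∧
      ∀ a, a - ρ a ∈ intLat K := by
  let r : Lat K → Lat K := fun a => Quotient.out (a : Lat K ⧸ intLat K)
  have hr : ∀ a, a - r a ∈ intLat K := by
    intro a
    have : ((r a : Lat K) : Lat K ⧸ intLat K) = a := QuotientAddGroup.out_eq' _
    rw [QuotientAddGroup.eq] at this
    rwa [sub_eq_add_neg, add_comm]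
  choose i j hij using hr
  -- Subtracting the sum of all the defects `j b`, `b ∈ S`, from every representative is one uniform
  -- shift that puts them below all elements of `S` at once.
  refine ⟨fun a => r a - latNat K (∑ b ∈ S, j b), ?_, ?_, ?_⟩
  · intro a ha
    have hle : j a ≤ ∑ b ∈ S, j b := Finset.single_le_sum (fun _ _ => zero_le) ha
    obtain ⟨l, hl⟩ := exists_add_of_le hle
    refine ⟨i a + l, ?_⟩
    have h1 : latNat K (i a) = a - r a + latNat K (j a) := by rw [hij a, sub_add_cancel]
    change a = r a - latNat K (∑ b ∈ S, j b) + latNat K (i a + l)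
    rw [hl, map_add, map_add, h1]
    abel
  · intro a b hab
    have : (a : Lat K ⧸ intLat K) = b := by
      rw [QuotientAddGroup.eq, ← neg_mem_iff]
      simpa [sub_eq_add_neg, add_comm] using hab
    simp only [r, this]
  · intro a
    have h1 := hij a
    refine ⟨i a + ∑ b ∈ S, j b, j a, ?_⟩
    rw [map_add, ← sub_add, h1]
    abel

end ExtBinom

/-! ### A vanishing expansion as a relation between point evaluations. -/

section Independence

variable {K M ι : Type*} [Field K] [CharZero K] [AddCommGroup M] [Module K M]

/-- The inner sum is what becomes of a term once `v^N` is rewritten through `u` and `u + v`: all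
terms of a class then share the exponent `b` of `v`, and only the exponents of `u + v` differ. The
coefficients of the expansion test these exponents against all binomial coefficients, so
interpolation allows any test function `φ`. -/
theorem sum_eq_zero_of_expansion_eq_zero (S : Finset ι) (B C b : ι → Lat K) (N : ι → ℕ × ℕ)
    (m : ι → M) (hB : ∀ t ∈ S, B t = b t + latNat K (N t))
    (hb : ∀ t ∈ S, ∀ u ∈ S, B t - B u ∈ intLat K → b t = b u)
    (h : ∀ Q, ∑ t ∈ S, extBinom (C t) (Q - B t) • m t = 0) (φ : Lat K → Lat K → K) :
    ∑ t ∈ S, (∑ x ∈ antidiag₂ (N t), natSign K x.2 * binom₂ (natPair K (N t)) x.1 *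
      φ (b t) (C t + latNat K x.1)) • m t = 0 := by
  classical
  rw [← Finset.sum_fiberwise_of_maps_to (t := S.image b)
    fun t ht => Finset.mem_image_of_mem b ht]
  refine Finset.sum_eq_zero fun b₀ hb₀ => ?_
  obtain ⟨t₀, ht₀, rfl⟩ := Finset.mem_image.1 hb₀
  set S₀ := S.filter fun t => b t = b t₀ with hS₀
  let m' : (Σ _ : ι, (ℕ × ℕ) × (ℕ × ℕ)) → M := fun p =>
    (natSign K p.2.2 * binom₂ (natPair K (N p.1)) p.2.1) • m p.1
  let β : (Σ _ : ι, (ℕ × ℕ) × (ℕ × ℕ)) → K × K := fun p =>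
    ((C p.1 + latNat K p.2.1 : Lat K) : K × K)
  have key := sum_smul_eq_zero_of_binom₂ (S₀.sigma fun t => antidiag₂ (N t)) β m' (by
      intro i
      rw [Finset.sum_sigma]
      have h1 : ∀ t ∈ S₀, ∑ x ∈ antidiag₂ (N t), binom₂ (β ⟨t, x⟩) i • m' ⟨t, x⟩ =
          extBinom (C t) (b t₀ + latNat K i - B t) • m t := by
        intro t ht
        obtain ⟨htS, htb⟩ := Finset.mem_filter.1 ht
        have e : b t₀ + latNat K i - B t = latNat K i - latNat K (N t) := by
          rw [hB t htS, htb]; abel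
        rw [e, extBinom_latNat_sub, ← sum_binom₂_mul_binom₂, Finset.sum_smul]
        refine Finset.sum_congr rfl fun x _ => ?_
        simp only [m', β, smul_smul]
        rw [AddSubgroup.coe_add, coe_latNat, mul_comm]
      rw [Finset.sum_congr rfl h1, ← h (b t₀ + latNat K i)]
      -- Terms of another class modulo `ℤ²` do not contribute at the exponent `b t₀ + i`.
      refine Finset.sum_subset (Finset.filter_subset _ _) fun t ht ht' => ?_
      rw [extBinom_eq_zero, zero_smul]
      intro k hk
      refine ht' (Finset.mem_filter.2 ⟨ht, hb t ht t₀ ht₀ ?_⟩)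
      have e : B t - B t₀ = latNat K i - latNat K k - latNat K (N t₀) := by
        rw [hk, hB t₀ ht₀]; abel
      rw [e]
      exact sub_mem (sub_mem (latNat_mem_intLat _) (latNat_mem_intLat _)) (latNat_mem_intLat _))
    -- Interpolation takes place on `K²`, so the test function is extended by zero; all the
    -- evaluation points lie in `Ǩ`.
    (fun z => if hz : z ∈ Lat K then φ (b t₀) ⟨z, hz⟩ else 0)
  rw [Finset.sum_sigma] at key
  rw [← key]
  refine Finset.sum_congr rfl fun t ht => ?_
  rw [Finset.sum_smul]
  refine Finset.sum_congr rfl fun x _ => ?_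
  have hz : β ⟨t, x⟩ ∈ Lat K := (C t + latNat K x.1).2
  rw [dif_pos hz, (Finset.mem_filter.1 ht).2]
  simp only [m', β, smul_smul]
  rw [mul_comm]

end Independence

/-! ### Finite sums of monomials in three variables of sum zero, and their expansions. -/

section Triples

/-- Exponents of monomials in three variables with sum zero. -/
abbrev Tri (K : Type*) [Field K] := Lat K × Lat K × Lat K

variable {K M : Type*} [Field K] [CharZero K] [AddCommGroup M] [Module K M]

/-- The total degree. -/
def triDeg (t : Tri K) : Lat K := t.1 + t.2.1 + t.2.2

/-- The exchange of the first two variables. -/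
def swap₁₂ (K : Type*) [Field K] : Tri K ≃ Tri K where
  toFun t := (t.2.1, t.1, t.2.2)
  invFun t := (t.2.1, t.1, t.2.2)
  left_inv _ := rfl
  right_inv _ := rfl

/-- The exchange of the first and the third variable. -/
def swap₁₃ (K : Type*) [Field K] : Tri K ≃ Tri K where
  toFun t := (t.2.2, t.2.1, t.1)
  invFun t := (t.2.2, t.2.1, t.1)
  left_inv _ := rfl
  right_inv _ := rfl

/-- The permutation of the variables of a finite sum of monomials. -/
noncomputable abbrev permTri (σ : Tri K ≃ Tri K) : (Tri K →₀ M) ≃ₗ[K] (Tri K →₀ M) :=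
  Finsupp.domLCongr σ

theorem permTri_apply (σ : Tri K ≃ Tri K) (e : Tri K →₀ M) (t : Tri K) :
    permTri (K := K) σ e t = e (σ.symm t) := rfl

/-- Homogeneity of degree `D`. -/
def IsHomog (D : Lat K) (e : Tri K →₀ M) : Prop := ∀ t, e t ≠ 0 → triDeg t = D

/-- The expansion of a finite sum of monomials of fixed degree in three variables `u, v, -(u+v)`
in nonnegative integer powers of `v`; the coefficients are indexed by the exponent of `v`. -/
noncomputable def expand : (Tri K →₀ M) →ₗ[K] (Lat K → M) :=
  Finsupp.lsum K fun t => LinearMap.pi fun Q =>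
    (sg t.2.2 * extBinom t.2.2 (Q - t.2.1)) • LinearMap.id

theorem expand_single (t : Tri K) (m : M) (Q : Lat K) :
    expand (Finsupp.single t m) Q = (sg t.2.2 * extBinom t.2.2 (Q - t.2.1)) • m := by
  simp [expand]

theorem expand_apply (e : Tri K →₀ M) (Q : Lat K) :
    expand e Q = ∑ t ∈ e.support, (sg t.2.2 * extBinom t.2.2 (Q - t.2.1)) • e t := by
  simp [expand, Finsupp.lsum_apply, Finsupp.sum, Finset.sum_apply]

theorem eq_sum_single (e : Tri K →₀ M) : e = ∑ t ∈ e.support, Finsupp.single t (e t) :=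
  (Finsupp.sum_single e).symm

theorem expand_permTri_apply (σ : Tri K ≃ Tri K) (e : Tri K →₀ M) (Q : Lat K) :
    expand (permTri (K := K) σ e) Q =
      ∑ t ∈ e.support, (sg (σ t).2.2 * extBinom (σ t).2.2 (Q - (σ t).2.1)) • e t := by
  conv_lhs => rw [eq_sum_single e]
  rw [map_sum, map_sum, Finset.sum_apply]
  refine Finset.sum_congr rfl fun t _ => ?_
  rw [permTri, Finsupp.domLCongr_single, expand_single]

theorem IsHomog.swap₁₂ {D : Lat K} {e : Tri K →₀ M} (h : IsHomog D e) :
    IsHomog D (permTri (K := K) (swap₁₂ K) e) := by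
  intro t ht
  rw [← h _ ht]
  simp only [triDeg, OPEAlg.swap₁₂, Equiv.coe_fn_symm_mk]
  abel

theorem IsHomog.swap₁₃ {D : Lat K} {e : Tri K →₀ M} (h : IsHomog D e) :
    IsHomog D (permTri (K := K) (swap₁₃ K) e) := by
  intro t ht
  rw [← h _ ht]
  simp only [triDeg, OPEAlg.swap₁₃, Equiv.coe_fn_symm_mk]
  abel

theorem IsHomog.sub {D : Lat K} {e e' : Tri K →₀ M} (h : IsHomog D e) (h' : IsHomog D e') :
    IsHomog D (e - e') := by
  intro t ht
  by_cases h0 : e t = 0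
  · refine h' t fun h1 => ht ?_
    rw [Finsupp.sub_apply, h0, h1, sub_zero]
  · exact h t h0

theorem IsHomog.smul {D : Lat K} {e : Tri K →₀ M} (h : IsHomog D e) (a : K) :
    IsHomog D (a • e) := by
  intro t ht
  refine h t fun h0 => ht ?_
  rw [Finsupp.smul_apply, h0, smul_zero]

theorem bddBelowOn_triOp_mulWt_atom (c B : Lat K) (m : M) :
    BddBelowOn (triOp (mulWt c) (atom B m)) := by
  intro Q
  by_cases h : ∃ k, latNat K k = Q - B
  · obtain ⟨k, hk⟩ := h
    refine (Finset.Iic k).finite_toSet.subset fun i hi => ?_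
    rw [Set.mem_ofPred_eq, triOp_mulWt_atom, sub_right_comm, ← hk, extBinom_latNat_sub] at hi
    rw [Finset.mem_coe, Finset.mem_Iic]
    by_contra hle
    exact hi (by rw [if_neg hle, zero_smul])
  · push Not at h
    convert Set.finite_empty (α := ℕ × ℕ)
    refine Set.eq_empty_of_forall_notMem fun i hi => hi ?_
    rw [triOp_mulWt_atom, sub_right_comm, extBinom_sub_latNat_eq_zero h, zero_smul]

theorem expand_eq_sum_triOp (e : Tri K →₀ M) : expand e =
    fun Q => ∑ t ∈ e.support, triOp (mulWt t.2.2) (atom t.2.1 (sg t.2.2 • e t)) Q := by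
  funext Q
  rw [expand_apply]
  refine Finset.sum_congr rfl fun t _ => ?_
  rw [triOp_mulWt_atom, smul_smul, mul_comm]

theorem triOp_shWt_atom (D B : Lat K) (m : M) (Q : Lat K) :
    triOp (shWt D) (atom B m) Q = (sg (D - B) * extBinom (D - B) (Q - B)) • m := by
  by_cases h : ∃ i, B + latNat K i = Q
  · obtain ⟨i, rfl⟩ := h
    rw [triOp_atom_latNat, add_sub_cancel_left, extBinom_latNat, shWt]
  · push Not at h
    rw [triOp_atom_eq_zero _ _ h, extBinom_eq_zero, mul_zero, zero_smul]
    intro i hi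
    exact h i (by rw [hi]; abel)

/-- Exchanging `u` with `-(u + v)` does not leave the domain `u > v`, so on expansions it is a
substitution. Homogeneity recovers the exponent of `u` from the other two. -/
theorem triOp_shWt_expand {D : Lat K} {e : Tri K →₀ M} (he : IsHomog D e) :
    triOp (shWt D) (expand e) = expand (permTri (K := K) (swap₁₃ K) e) := by
  rw [expand_eq_sum_triOp, triOp_sum _ fun t _ => bddBelowOn_triOp_mulWt_atom _ _ _]
  funext Q
  rw [expand_permTri_apply]
  refine Finset.sum_congr rfl fun t ht => ?_
  rw [triOp_shWt_mulWt (bddBelowOn_atom _ _)]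
  beta_reduce
  rw [triOp_shWt_atom, smul_smul, smul_smul]
  have e1 : D - t.2.2 - t.2.1 = t.1 := by
    rw [← he t (Finsupp.mem_support_iff.1 ht), triDeg]; abel
  rw [e1]
  change _ = (sg t.1 * extBinom t.1 (Q - t.2.1)) • e t
  congr 1
  linear_combination (sg t.1 * extBinom t.1 (Q - t.2.1)) * sg_mul_self t.2.2

theorem exists_sum_eq_zero_of_expand_eq_zero {e : Tri K →₀ M} (h : expand e = 0) :
    ∃ (ρ : Lat K → Lat K) (N : Tri K → ℕ × ℕ),
      (∀ t ∈ e.support, t.2.1 = ρ t.2.1 + latNat K (N t)) ∧ ∀ φ : Lat K → Lat K → K,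
      ∑ t ∈ e.support, (∑ x ∈ antidiag₂ (N t), natSign K x.2 * binom₂ (natPair K (N t)) x.1 *
        φ (ρ t.2.1) (t.2.2 + latNat K x.1)) • sg t.2.2 • e t = 0 := by
  classical
  obtain ⟨ρ, hρ, hρ', -⟩ := exists_lower_representatives (e.support.image fun t => t.2.1)
  have hN : ∀ t, ∃ N, t ∈ e.support → t.2.1 = ρ t.2.1 + latNat K N := by
    intro t
    by_cases ht : t ∈ e.support
    · obtain ⟨N, hN⟩ := hρ _ (Finset.mem_image_of_mem _ ht)
      exact ⟨N, fun _ => hN⟩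
    · exact ⟨0, fun h => absurd h ht⟩
  choose N hN using hN
  refine ⟨ρ, N, hN, fun φ => sum_eq_zero_of_expansion_eq_zero e.support (fun t => t.2.1)
    (fun t => t.2.2) (fun t => ρ t.2.1) N (fun t => sg t.2.2 • e t) hN
    (fun t _ u _ hu => hρ' _ _ hu) (fun Q => ?_) φ⟩
  have := congrFun h Q
  rw [expand_apply, Pi.zero_apply] at this
  rw [← this]
  exact Finset.sum_congr rfl fun t _ => by rw [smul_smul, mul_comm]

/-- The decisive step: a relation seen in the domain `u > v` persists in `v > u`. The relation holds
against every test function, and each coefficient of the other expansion is such a test. -/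
theorem expand_swap₁₂_eq_zero {D : Lat K} {e : Tri K →₀ M} (he : IsHomog D e)
    (h : expand e = 0) : expand (permTri (K := K) (swap₁₂ K) e) = 0 := by
  classical
  funext P
  rw [expand_permTri_apply]
  obtain ⟨ρ, N, hN, key⟩ := exists_sum_eq_zero_of_expand_eq_zero h
  -- For a monomial with exponents `b` of `v` and `β` of the third variable, the exponent of `u` is
  -- `D - b - β`; hence this is its coefficient at `u^P`, up to sign.
  replace key := key (fun b β => extBinom β (P - D + b + β))
  rw [Pi.zero_apply, ← key]
  refine Finset.sum_congr rfl fun t ht => ?_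
  rw [smul_smul, mul_comm]
  congr 2
  rw [← sum_natSign_mul_extBinom _ _ (N t)]
  refine Finset.sum_congr rfl fun x hx => ?_
  congr 2
  have h1 := hN t ht
  rw [← mem_antidiag₂.1 hx, map_add] at h1
  rw [← he t (Finsupp.mem_support_iff.1 ht), triDeg]
  change P - t.1 - latNat K x.2 = _
  nth_rewrite 1 [h1]
  abel

/-- Terms with pairwise incongruent third exponents are determined by their expansion. -/
theorem eq_zero_of_expand_eq_zero {D : Lat K} {e : Tri K →₀ M} (he : IsHomog D e)
    (hC : ∀ t u, e t ≠ 0 → e u ≠ 0 → t.2.2 - u.2.2 ∈ intLat K → t.2.2 = u.2.2)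
    (h : expand e = 0) : e = 0 := by
  classical
  ext t₀
  by_contra ht₀
  rw [Finsupp.zero_apply] at ht₀
  have hmem : t₀ ∈ e.support := Finsupp.mem_support_iff.2 ht₀
  obtain ⟨ρ, N, hN, key⟩ := exists_sum_eq_zero_of_expand_eq_zero h
  -- A test function isolating `t₀`. The conditions select its classes, and the binomial coefficient
  -- of index `N t₀` turns the signed inner sum of a remaining term `t` into `binom₂ 0 (N t₀ - N t)`
  -- or zero, which vanishes unless `N t = N t₀`.
  replace key := key (fun b β => if b = ρ t₀.2.1 ∧ β - t₀.2.2 ∈ intLat K then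
      binom₂ ((β - t₀.2.2 : Lat K) : K × K) (N t₀) else 0)
  rw [Finset.sum_eq_single_of_mem _ hmem] at key
  · have h1 := sum_binom₂_mul_binom₂ (0 : K × K) (N t₀) (N t₀)
    rw [if_pos le_rfl, tsub_self, binom₂_zero_right] at h1
    have h2 : ∀ x : (ℕ × ℕ) × (ℕ × ℕ), t₀.2.2 + latNat K x.1 - t₀.2.2 = latNat K x.1 := by
      intro x; abel
    simp only [h2, latNat_mem_intLat, and_self, if_true, coe_latNat] at key
    simp only [zero_add] at h1
    rw [h1, one_smul] at key
    exact ht₀ ((smul_eq_zero_iff_right (sg_ne_zero _)).1 key)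
  · intro t ht hne
    have ht' := Finsupp.mem_support_iff.1 ht
    by_cases hb : ρ t.2.1 = ρ t₀.2.1
    · by_cases hc : t.2.2 = t₀.2.2
      · have h1 := sum_binom₂_mul_binom₂ (0 : K × K) (N t) (N t₀)
        have h2 : ∀ x : (ℕ × ℕ) × (ℕ × ℕ), t.2.2 + latNat K x.1 - t₀.2.2 = latNat K x.1 := by
          intro x; rw [hc]; abel
        simp only [h2, latNat_mem_intLat, hb, and_self, if_true, coe_latNat]
        simp only [zero_add] at h1
        rw [h1]
        split_ifs with hle
        · rw [binom₂_zero_left, if_neg, zero_smul]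
          intro h0
          have hNN : N t = N t₀ := le_antisymm hle (tsub_eq_zero_iff_le.1 h0)
          have hBB : t.2.1 = t₀.2.1 := by rw [hN t ht, hN t₀ hmem, hb, hNN]
          refine hne (Prod.ext ?_ (Prod.ext hBB hc))
          have hd := (he t ht').trans (he t₀ ht₀).symm
          rw [triDeg, triDeg, hBB, hc] at hd
          exact add_right_cancel (add_right_cancel hd)
        · rw [zero_smul]
      · rw [Finset.sum_eq_zero, zero_smul]
        intro x _
        rw [if_neg, mul_zero]
        rintro ⟨-, hi⟩
        refine hc (hC t t₀ ht' ht₀ ?_)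
        have := sub_mem hi (latNat_mem_intLat x.1)
        convert this using 1
        abel
    · simp only [hb, false_and, if_false, mul_zero, Finset.sum_const_zero, zero_smul]

/-- The replacement of `N t` factors of the third variable of each monomial `t` by the expression
in the other two variables. -/
noncomputable def collapse (N : Tri K → ℕ × ℕ) : (Tri K →₀ M) →ₗ[K] (Tri K →₀ M) :=
  Finsupp.lsum K fun t => ∑ x ∈ antidiag₂ (N t),
    (natSign K (N t) * binom₂ (natPair K (N t)) x.2) •
      Finsupp.lsingle (t.1 + latNat K x.1, t.2.1 + latNat K x.2, t.2.2 - latNat K (N t))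

theorem collapse_single (N : Tri K → ℕ × ℕ) (t : Tri K) (m : M) :
    collapse N (Finsupp.single t m) = ∑ x ∈ antidiag₂ (N t),
      (natSign K (N t) * binom₂ (natPair K (N t)) x.2) •
      Finsupp.single
        ((t.1 + latNat K x.1, t.2.1 + latNat K x.2, t.2.2 - latNat K (N t)) : Tri K) m := by
  simp [collapse]

/-- Replacing `(-(u + v))^N` by its finite binomial expansion is a polynomial identity, so the
series is unchanged. -/
theorem expand_collapse (N : Tri K → ℕ × ℕ) (e : Tri K →₀ M) :
    expand (collapse N e) = expand e := by
  rw [eq_sum_single e, map_sum, map_sum, map_sum]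
  refine Finset.sum_congr rfl fun t _ => ?_
  funext Q
  rw [collapse_single, map_sum, Finset.sum_apply, expand_single]
  have h := sum_binom₂_mul_extBinom (t.2.2 - latNat K (N t)) (Q - t.2.1) (N t)
  rw [sub_add_cancel] at h
  rw [← h, Finset.mul_sum, Finset.sum_smul]
  refine Finset.sum_congr rfl fun x _ => ?_
  rw [map_smul, Pi.smul_apply, expand_single, smul_smul, sg_sub, sg_latNat, sub_sub]
  congr 1
  linear_combination (sg t.2.2 * binom₂ (natPair K (N t)) x.2 *
    extBinom (t.2.2 - latNat K (N t)) (Q - (t.2.1 + latNat K x.2))) * natSign_mul_self (K := K) (N t)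

theorem exists_of_collapse_ne_zero {N : Tri K → ℕ × ℕ} {e : Tri K →₀ M} {u : Tri K}
    (h : collapse N e u ≠ 0) : ∃ t, e t ≠ 0 ∧ ∃ x ∈ antidiag₂ (N t),
      u = (t.1 + latNat K x.1, t.2.1 + latNat K x.2, t.2.2 - latNat K (N t)) := by
  classical
  rw [eq_sum_single e, map_sum, Finsupp.finsetSum_apply] at h
  obtain ⟨t, ht, h⟩ := Finset.exists_ne_zero_of_sum_ne_zero h
  refine ⟨t, Finsupp.mem_support_iff.1 ht, ?_⟩
  rw [collapse_single, Finsupp.finsetSum_apply] at h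
  obtain ⟨x, hx, h⟩ := Finset.exists_ne_zero_of_sum_ne_zero h
  refine ⟨x, hx, ?_⟩
  by_contra hne
  exact h (by rw [Finsupp.smul_apply, Finsupp.single_apply, if_neg (Ne.symm hne), smul_zero])

theorem IsHomog.collapse {D : Lat K} {e : Tri K →₀ M} (he : IsHomog D e)
    (N : Tri K → ℕ × ℕ) : IsHomog D (collapse N e) := by
  intro u hu
  obtain ⟨t, ht, x, hx, rfl⟩ := exists_of_collapse_ne_zero hu
  rw [← he t ht, triDeg, triDeg, ← mem_antidiag₂.1 hx, map_add]
  dsimp only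
  generalize latNat K x.1 = a, latNat K x.2 = b
  abel

end Triples

/-! ### Translation between distributions and sums of monomials of fixed degree. -/

section Coefficients

variable {K M : Type*} [Field K] [CharZero K] [AddCommGroup M] [Module K M]

/-- The coefficient of a distribution at exponents in `Ǩ`. -/
def coeff₂ (f : Dist₂ K M) (P Q : Lat K) : M := f (-(P : K × K) - 1) (-(Q : K × K) - 1)

open Classical in
/-- The distribution with given coefficients at exponents in `Ǩ`. -/
noncomputable def toDist (f : Lat K → Lat K → M) : Dist₂ K M := fun n m =>
  if h : n ∈ Lat K ∧ m ∈ Lat K then f (-⟨n, h.1⟩ - latOne K) (-⟨m, h.2⟩ - latOne K) else 0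

/-- Boundedness below of a family of coefficients in both variables. -/
def SerBdd (f : Lat K → Lat K → M) : Prop :=
  ∃ S : Finset (Lat K × Lat K), ∀ P Q, f P Q ≠ 0 →
    ∃ s ∈ S, ∃ i j, P = s.1 + latNat K i ∧ Q = s.2 + latNat K j

/-- A distribution whose modes are supported in `Ǩ`. -/
def LatSupported (f : Dist₂ K M) : Prop := ∀ n m, f n m ≠ 0 → n ∈ Lat K ∧ m ∈ Lat K

theorem coeff₂_toDist (f : Lat K → Lat K → M) : coeff₂ (toDist f) = f := by
  funext P Q
  have h : ∀ P : Lat K, -(P : K × K) - 1 ∈ Lat K := fun P => (-P - latOne K).2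
  rw [coeff₂, toDist, dif_pos ⟨h P, h Q⟩]
  congr 1 <;> ext <;> simp

theorem latSupported_toDist (f : Lat K → Lat K → M) : LatSupported (toDist f) := by
  intro n m h
  by_contra hn
  exact h (dif_neg hn)

theorem LatSupported.ext {f g : Dist₂ K M} (hf : LatSupported f) (hg : LatSupported g)
    (h : coeff₂ f = coeff₂ g) : f = g := by
  funext n m
  by_cases hn : n ∈ Lat K ∧ m ∈ Lat K
  · have := congrFun (congrFun h (-⟨n, hn.1⟩ - latOne K)) (-⟨m, hn.2⟩ - latOne K)
    simpa [coeff₂] using this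
  · have h1 : f n m = 0 := by
      by_contra h0
      exact hn (hf _ _ h0)
    have h2 : g n m = 0 := by
      by_contra h0
      exact hn (hg _ _ h0)
    rw [h1, h2]

theorem LatSupported.sum {ι : Type*} {s : Finset ι} {f : ι → Dist₂ K M}
    (h : ∀ t ∈ s, LatSupported (f t)) : LatSupported (∑ t ∈ s, f t) := by
  intro n m hn
  rw [Finset.sum_apply, Finset.sum_apply] at hn
  obtain ⟨t, ht, h'⟩ := Finset.exists_ne_zero_of_sum_ne_zero hn
  exact h t ht n m h'

theorem LatSupported.smul {f : Dist₂ K M} (h : LatSupported f) (a : K) : LatSupported (a • f) := by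
  intro n m hn
  refine h n m fun h0 => hn ?_
  rw [Pi.smul_apply, Pi.smul_apply, h0, smul_zero]

theorem coeff₂_sum {ι : Type*} (s : Finset ι) (f : ι → Dist₂ K M) (P Q : Lat K) :
    coeff₂ (∑ t ∈ s, f t) P Q = ∑ t ∈ s, coeff₂ (f t) P Q := by
  simp [coeff₂, Finset.sum_apply]

theorem coeff₂_smul (a : K) (f : Dist₂ K M) (P Q : Lat K) :
    coeff₂ (a • f) P Q = a • coeff₂ f P Q := rfl

theorem add_mem_lat_iff {n k : K × K} (hk : k ∈ Lat K) : n + k ∈ Lat K ↔ n ∈ Lat K :=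
  (Lat K).add_mem_cancel_right hk

theorem sub_mem_lat_iff {n k : K × K} (hk : k ∈ Lat K) : n - k ∈ Lat K ↔ n ∈ Lat K := by
  rw [sub_eq_add_neg]
  exact add_mem_lat_iff (neg_mem hk)

theorem LatSupported.mulPowFst {f : Dist₂ K M} (hf : LatSupported f) (ν : K) {κ : K × K}
    (hκ : κ ∈ Lat K) : LatSupported (mulPowFst ν κ f) := by
  intro n m h
  obtain ⟨i, hi⟩ : ∃ i, _ ≠ _ := by
    by_contra! h0
    exact h (finsum_eq_zero_of_forall_eq_zero h0)
  have := hf _ _ fun h0 => hi (by rw [h0, smul_zero])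
  rwa [sub_mem_lat_iff (natPair_mem_lat i), add_mem_lat_iff hκ,
    add_mem_lat_iff (natPair_mem_lat i)] at this

theorem LatSupported.mulPowSnd {f : Dist₂ K M} (hf : LatSupported f) (ν : K) {κ : K × K}
    (hκ : κ ∈ Lat K) : LatSupported (mulPowSnd ν κ f) := by
  intro n m h
  obtain ⟨i, hi⟩ : ∃ i, _ ≠ _ := by
    by_contra! h0
    exact h (finsum_eq_zero_of_forall_eq_zero h0)
  have := hf _ _ fun h0 => hi (by rw [h0, smul_zero])
  rwa [sub_mem_lat_iff (natPair_mem_lat i), add_mem_lat_iff hκ,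
    add_mem_lat_iff (natPair_mem_lat i)] at this

theorem coeff₂_mulPowFst_one (κ : Lat K) (d : Dist₂ K M) (P Q : Lat K) :
    coeff₂ (mulPowFst 1 (κ : K × K) d) P Q =
      triOp (mulWt κ) (fun B => coeff₂ d (P + Q - κ - B) B) Q := by
  rw [coeff₂, mulPowFst, triOp]
  refine finsum_congr fun i => ?_
  rw [one_pow, mul_one, mulWt, coeff₂]
  congr 2
  · push_cast
    rw [coe_latNat]
    abel
  · push_cast
    rw [coe_latNat]
    abel

theorem coeff₂_mulPowSnd_one (κ : Lat K) (d : Dist₂ K M) (P Q : Lat K) :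
    coeff₂ (mulPowSnd 1 (κ : K × K) d) P Q =
      triOp (mulWt κ) (fun A => coeff₂ d A (P + Q - κ - A)) P := by
  rw [coeff₂, mulPowSnd, triOp]
  refine finsum_congr fun i => ?_
  rw [one_pow, mul_one, mulWt, coeff₂]
  congr 2
  · push_cast
    rw [coe_latNat]
    abel
  · push_cast
    rw [coe_latNat]
    abel

/-- Conjugation by the sign of the first exponent, that is `ž ↦ -ž`, turns `(ž - w̌)^κ` into `sg κ`
times the power of the sum. -/
theorem coeff₂_mulPowFst_neg_one (κ : Lat K) (d : Dist₂ K M) (P Q : Lat K) :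
    coeff₂ (mulPowFst (-1) (κ : K × K) d) P Q =
      (sg P * sg κ) • triOp (mulWt κ)
        (fun B => sg (P + Q - κ - B) • coeff₂ d (P + Q - κ - B) B) Q := by
  rw [coeff₂, mulPowFst, triOp, smul_finsum]
  refine finsum_congr fun i => ?_
  rw [smul_smul, smul_smul, mulWt, coeff₂]
  have e : P + Q - κ - (Q - latNat K i) = P - κ + latNat K i := by abel
  rw [e, sg_add, sg_sub, sg_latNat]
  congr 1
  · rw [← natSign]
    linear_combination (-(binom₂ (κ : K × K) i * natSign K i)) * sg_mul_self P -
      (binom₂ (κ : K × K) i * natSign K i * (sg P * sg P)) * sg_mul_self κ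
  · congr 1
    · push_cast
      rw [coe_latNat]
      abel
    · push_cast
      rw [coe_latNat]
      abel

theorem coeff₂_mulPowSubOpp (κ : Lat K) (d : Dist₂ K M) (P Q : Lat K) :
    coeff₂ (mulPowSubOpp (κ : K × K) d) P Q =
      (sg P * sg κ) • triOp (mulWt κ) (fun A => sg A • coeff₂ d A (P + Q - κ - A)) P := by
  rw [mulPowSubOpp, coeff₂_smul, coeff₂, mulPowSnd, triOp, smul_finsum, smul_finsum]
  refine finsum_congr fun i => ?_
  rw [smul_smul, smul_smul, smul_smul, mulWt, coeff₂, sg_sub, sg_latNat]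
  congr 1
  · rw [← natSign, ← sg]
    linear_combination (-(sg κ * binom₂ (κ : K × K) i * natSign K i)) * sg_mul_self P
  · congr 1
    · push_cast
      rw [coe_latNat]
      abel
    · push_cast
      rw [coe_latNat]
      abel

theorem serBdd_coeff₂ {d : Dist₂ K M} (h : IsVertexSeries₂ d) : SerBdd (coeff₂ d) := by
  classical
  obtain ⟨r, h, h', hd⟩ := h
  let g : Fin r → Lat K × Lat K := fun i =>
    if hi : h i ∈ Lat K ∧ h' i ∈ Lat K then (-⟨h i, hi.1⟩, -⟨h' i, hi.2⟩) else 0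
  refine ⟨Finset.univ.image g, fun P Q hPQ => ?_⟩
  obtain ⟨i, k, l, h1, h2⟩ := hd _ _ hPQ
  have e1 : h i = ((-P + latNat K k : Lat K) : K × K) := by
    push_cast
    rw [coe_latNat]
    linear_combination (exp := 1) -h1
  have e2 : h' i = ((-Q + latNat K l : Lat K) : K × K) := by
    push_cast
    rw [coe_latNat]
    linear_combination (exp := 1) -h2
  have hi : h i ∈ Lat K ∧ h' i ∈ Lat K := by
    rw [e1, e2]
    exact ⟨SetLike.coe_mem _, SetLike.coe_mem _⟩
  refine ⟨g i, Finset.mem_image_of_mem _ (Finset.mem_univ _), k, l, ?_, ?_⟩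
  · simp only [g, dif_pos hi]
    ext1
    push_cast
    rw [e1]
    push_cast
    abel
  · simp only [g, dif_pos hi]
    ext1
    push_cast
    rw [e2]
    push_cast
    abel

theorem isVertexSeries₂_toDist {f : Lat K → Lat K → M} (hf : SerBdd f) :
    IsVertexSeries₂ (toDist f) := by
  obtain ⟨S, hS⟩ := hf
  refine ⟨S.card, fun i => -((S.equivFin.symm i : Lat K × Lat K).1 : K × K),
    fun i => -((S.equivFin.symm i : Lat K × Lat K).2 : K × K), fun n m h => ?_⟩
  have hn := latSupported_toDist f n m h
  rw [toDist, dif_pos hn] at h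
  obtain ⟨s, hs, i, j, h1, h2⟩ := hS _ _ h
  refine ⟨S.equivFin ⟨s, hs⟩, i, j, ?_, ?_⟩
  · beta_reduce
    rw [Equiv.symm_apply_apply]
    have := congrArg (Subtype.val) h1
    push_cast at this
    simp only [coe_latNat, coe_latOne] at this
    linear_combination (exp := 1) -this
  · beta_reduce
    rw [Equiv.symm_apply_apply]
    have := congrArg (Subtype.val) h2
    push_cast at this
    simp only [coe_latNat, coe_latOne] at this
    linear_combination (exp := 1) -this

/-- Both exponents are bounded below, and the fixed degree fixes the sum of the two shifts above
each lower bound. -/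
theorem SerBdd.finite_support {f : Lat K → Lat K → M} (hf : SerBdd f) (D κ : Lat K) :
    {t : Tri K | t.2.2 = κ ∧ triDeg t = D ∧ f t.1 t.2.1 ≠ 0}.Finite := by
  classical
  obtain ⟨S, hS⟩ := hf
  have hfin : ∀ s : Lat K × Lat K,
      {x : (ℕ × ℕ) × (ℕ × ℕ) | s.1 + s.2 + κ + latNat K (x.1 + x.2) = D}.Finite := by
    intro s
    by_cases h : ∃ l, s.1 + s.2 + κ + latNat K l = D
    · obtain ⟨l, hl⟩ := h
      refine (antidiag₂ l).finite_toSet.subset fun x hx => ?_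
      rw [Finset.mem_coe, mem_antidiag₂]
      exact latNat_injective (add_left_cancel (hx.trans hl.symm))
    · convert Set.finite_empty (α := (ℕ × ℕ) × (ℕ × ℕ))
      exact Set.eq_empty_of_forall_notMem fun x hx => h ⟨_, hx⟩
  refine (S.finite_toSet.biUnion fun s _ => (hfin s).image fun x =>
    ((s.1 + latNat K x.1, s.2 + latNat K x.2, κ) : Tri K)).subset ?_
  rintro ⟨A, B, C⟩ ⟨hC, hD, h⟩
  obtain ⟨s, hs, i, j, h1, h2⟩ := hS _ _ h
  simp only at hC h1 h2
  subst hC h1 h2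
  refine Set.mem_biUnion hs ⟨(i, j), ?_, rfl⟩
  rw [← hD]
  change s.1 + s.2 + C + latNat K (i + j) = s.1 + latNat K i + (s.2 + latNat K j) + C
  rw [map_add]
  abel

open Classical in
/-- The terms of degree `D` of the product of a series with the `κ`-th power of the third
variable. -/
noncomputable def ofSeries (κ : Lat K) {f : Lat K → Lat K → M} (hf : SerBdd f) (D : Lat K) :
    Tri K →₀ M :=
  Finsupp.ofSupportFinite
    (fun t => if t.2.2 = κ ∧ triDeg t = D then sg κ • f t.1 t.2.1 else 0)
    ((hf.finite_support D κ).subset fun t ht => by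
      rw [Function.mem_support] at ht
      split_ifs at ht with h
      · exact ⟨h.1, h.2, fun h0 => ht (by rw [h0, smul_zero])⟩
      · exact absurd rfl ht)

open Classical in
theorem ofSeries_apply (κ : Lat K) {f : Lat K → Lat K → M} (hf : SerBdd f) (D : Lat K)
    (t : Tri K) : ofSeries κ hf D t =
      if t.2.2 = κ ∧ triDeg t = D then sg κ • f t.1 t.2.1 else 0 := rfl

theorem ofSeries_ne_zero {κ : Lat K} {f : Lat K → Lat K → M} {hf : SerBdd f} {D : Lat K}
    {t : Tri K} (h : ofSeries κ hf D t ≠ 0) : t.2.2 = κ ∧ triDeg t = D ∧ f t.1 t.2.1 ≠ 0 := by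
  classical
  rw [ofSeries_apply] at h
  split_ifs at h with h'
  · exact ⟨h'.1, h'.2, fun h0 => h (by rw [h0, smul_zero])⟩
  · exact absurd rfl h

theorem isHomog_ofSeries (κ : Lat K) {f : Lat K → Lat K → M} (hf : SerBdd f) (D : Lat K) :
    IsHomog D (ofSeries κ hf D) := fun _ ht => (ofSeries_ne_zero ht).2.1

theorem expand_of_third_eq {D κ : Lat K} {e : Tri K →₀ M} (he : IsHomog D e)
    (hκ : ∀ t, e t ≠ 0 → t.2.2 = κ) : expand e =
      triOp (mulWt κ) (fun B => sg κ • e (D - κ - B, B, κ)) := by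
  classical
  have h1 : (fun B => sg κ • e (D - κ - B, B, κ)) =
      fun B => ∑ t ∈ e.support, atom t.2.1 (sg κ • e t) B := by
    have hne : ∀ t B, e t ≠ 0 → t ≠ (D - κ - B, B, κ) → atom t.2.1 (sg κ • e t) B = 0 := by
      intro t B ht hne
      refine atom_of_ne (fun hB => hne ?_) _
      refine Prod.ext ?_ (Prod.ext hB.symm (hκ t ht))
      rw [← he t ht, ← hκ t ht, hB, triDeg]
      abel
    funext B
    by_cases h : e (D - κ - B, B, κ) = 0
    · rw [h, smul_zero, Finset.sum_eq_zero]
      intro t ht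
      refine hne t B (Finsupp.mem_support_iff.1 ht) ?_
      rintro rfl
      exact Finsupp.mem_support_iff.1 ht h
    · rw [Finset.sum_eq_single_of_mem _ (Finsupp.mem_support_iff.2 h)]
      · rw [atom_self]
      · intro t ht ht'
        exact hne t B (Finsupp.mem_support_iff.1 ht) ht'
  rw [h1, triOp_sum _ fun t _ => bddBelowOn_atom _ _, expand_eq_sum_triOp]
  funext Q
  refine Finset.sum_congr rfl fun t ht => ?_
  rw [hκ t (Finsupp.mem_support_iff.1 ht)]

theorem expand_of_third_mem {D : Lat K} {e : Tri K →₀ M} (he : IsHomog D e) (S : Finset (Lat K))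
    (hS : ∀ t, e t ≠ 0 → t.2.2 ∈ S) (Q : Lat K) : expand e Q =
      ∑ κ ∈ S, triOp (mulWt κ) (fun B => sg κ • e (D - κ - B, B, κ)) Q := by
  classical
  have h1 : e = ∑ κ ∈ S, e.filter fun t => t.2.2 = κ := by
    ext t
    rw [Finsupp.finsetSum_apply]
    by_cases h : e t = 0
    · rw [h, Finset.sum_eq_zero]
      intro κ _
      rw [Finsupp.filter_apply, h, ite_self]
    · rw [Finset.sum_eq_single_of_mem _ (hS t h)]
      · rw [Finsupp.filter_apply, if_pos rfl]
      · intro κ _ hne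
        rw [Finsupp.filter_apply, if_neg hne.symm]
  conv_lhs => rw [h1]
  rw [map_sum, Finset.sum_apply]
  refine Finset.sum_congr rfl fun κ _ => ?_
  have hf : ∀ t, e.filter (fun t => t.2.2 = κ) t ≠ 0 → t.2.2 = κ ∧ e t ≠ 0 := by
    intro t ht
    rw [Finsupp.filter_apply] at ht
    split_ifs at ht with h
    · exact ⟨h, ht⟩
    · exact absurd rfl ht
  rw [expand_of_third_eq (fun t ht => he t (hf t ht).2) fun t ht => (hf t ht).1]
  congr 1
  funext B
  rw [Finsupp.filter_apply, if_pos rfl]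

theorem expand_ofSeries (κ : Lat K) {f : Lat K → Lat K → M} (hf : SerBdd f) (D : Lat K) :
    expand (ofSeries κ hf D) = triOp (mulWt κ) (fun B => f (D - κ - B) B) := by
  rw [expand_of_third_eq (isHomog_ofSeries κ hf D) fun t ht => (ofSeries_ne_zero ht).1]
  congr 1
  funext B
  rw [ofSeries_apply, if_pos, smul_smul, sg_mul_self, one_smul]
  refine ⟨rfl, ?_⟩
  change D - κ - B + B + κ = D
  abel

theorem expand_swap₁₂_ofSeries (κ : Lat K) {f : Lat K → Lat K → M} (hf : SerBdd f) (D : Lat K) :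
    expand (permTri (K := K) (swap₁₂ K) (ofSeries κ hf D)) =
      triOp (mulWt κ) (fun A => f A (D - κ - A)) := by
  rw [expand_of_third_eq (isHomog_ofSeries κ hf D).swap₁₂
    (fun t ht => (ofSeries_ne_zero (hf := hf) (t := (swap₁₂ K).symm t) ht).1)]
  congr 1
  funext A
  rw [permTri_apply, ofSeries_apply, if_pos, smul_smul, sg_mul_self, one_smul]
  · rfl
  · refine ⟨rfl, ?_⟩
    simp only [triDeg, swap₁₂, Equiv.coe_fn_symm_mk]
    abel

end Coefficients

/-! ### Families of sums representing a pair of expansions. -/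

section Representatives

variable {K M : Type*} [Field K] [CharZero K] [AddCommGroup M] [Module K M]

/-- Uniform boundedness below of a family of finite sums of monomials. -/
def TriBdd (E : Lat K → Tri K →₀ M) : Prop :=
  ∃ S : Finset (Tri K), ∀ D t, E D t ≠ 0 → ∃ s ∈ S, ∃ i j k,
    t = (s.1 + latNat K i, s.2.1 + latNat K j, s.2.2 + latNat K k)

/-- Boundedness of a family of finite sums of monomials in the first variable. -/
def FstBdd (E : Lat K → Tri K →₀ M) {r : ℕ} (h : Fin r → K × K) : Prop :=
  ∀ D t, E D t ≠ 0 → ∃ i k, (t.1 : K × K) = -h i + natPair K k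

/-- The family `E` of homogeneous sums of monomials in three variables `u, v, -(u+v)` has the
expansion `F(u, v)` in the domain `u > v` and the expansion `G(u, v)` in the domain `v > u`. -/
structure IsRep (F G : Lat K → Lat K → M) (E : Lat K → Tri K →₀ M) : Prop where
  homog : ∀ D, IsHomog D (E D)
  bdd : TriBdd E
  fst : ∀ D Q, expand (E D) Q = F (D - Q) Q
  snd : ∀ D P, expand (permTri (K := K) (swap₁₂ K) (E D)) P = G P (D - P)

theorem expand_swap₁₂_congr {D : Lat K} {e e' : Tri K →₀ M} (he : IsHomog D e)
    (he' : IsHomog D e') (h : expand e = expand e') :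
    expand (permTri (K := K) (swap₁₂ K) e) = expand (permTri (K := K) (swap₁₂ K) e') := by
  have := expand_swap₁₂_eq_zero (he.sub he') (by rw [map_sub, h, sub_self])
  rwa [map_sub, map_sub, sub_eq_zero] at this

theorem permTri_swap₁₂_swap₁₂ (e : Tri K →₀ M) :
    permTri (K := K) (swap₁₂ K) (permTri (K := K) (swap₁₂ K) e) = e := by
  ext t
  rfl

theorem permTri_swap₁₃_swap₁₃ (e : Tri K →₀ M) :
    permTri (K := K) (swap₁₃ K) (permTri (K := K) (swap₁₃ K) e) = e := by
  ext t
  rfl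

/-- Only one expansion has to be compared, since it determines the other. -/
theorem IsRep.congr {F G : Lat K → Lat K → M} {E E' : Lat K → Tri K →₀ M} (h : IsRep F G E)
    (hh : ∀ D, IsHomog D (E' D)) (hb : TriBdd E') (he : ∀ D, expand (E' D) = expand (E D)) :
    IsRep F G E' :=
  ⟨hh, hb, fun D Q => by rw [he, h.fst],
    fun D P => by rw [expand_swap₁₂_congr (hh D) (h.homog D) (he D), h.snd]⟩

/-- Normalises the third exponents to a prescribed finite set. Collapsing only raises the first two
exponents, whence the last clause, by which bounds in the first variable survive. -/
theorem exists_collapse {E : Lat K → Tri K →₀ M} (hE : ∀ D, IsHomog D (E D)) (hb : TriBdd E)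
    (S : Finset (Lat K))
    (hS : ∀ D t, E D t ≠ 0 → ∃ N, t.2.2 - latNat K N ∈ S) :
    ∃ E' : Lat K → Tri K →₀ M, (∀ D, IsHomog D (E' D)) ∧ TriBdd E' ∧
      (∀ D, expand (E' D) = expand (E D)) ∧ (∀ D t, E' D t ≠ 0 → t.2.2 ∈ S) ∧
      ∀ D u, E' D u ≠ 0 → ∃ t, E D t ≠ 0 ∧ ∃ i, u.1 = t.1 + latNat K i := by
  classical
  have hN : ∀ t, ∃ N, ∀ D, E D t ≠ 0 → t.2.2 - latNat K N ∈ S := by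
    intro t
    by_cases ht : ∃ D, E D t ≠ 0
    · obtain ⟨D, hD⟩ := ht
      obtain ⟨N, hN⟩ := hS D t hD
      exact ⟨N, fun _ _ => hN⟩
    · exact ⟨0, fun D hD => absurd ⟨D, hD⟩ ht⟩
  choose N hN using hN
  refine ⟨fun D => collapse N (E D), fun D => (hE D).collapse N, ?_,
    fun D => expand_collapse N _, ?_, ?_⟩
  · obtain ⟨S', hS'⟩ := hb
    refine ⟨(S' ×ˢ S).image fun s => (s.1.1, s.1.2.1, s.2), fun D u hu => ?_⟩
    obtain ⟨t, ht, x, hx, rfl⟩ := exists_of_collapse_ne_zero hu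
    obtain ⟨s, hs, i, j, k, rfl⟩ := hS' D t ht
    refine ⟨_, Finset.mem_image_of_mem _ (Finset.mk_mem_product hs (hN _ D ht)),
      i + x.1, j + x.2, 0, ?_⟩
    simp only [map_add, map_zero, add_zero, add_assoc]
  · intro D u hu
    obtain ⟨t, ht, x, hx, rfl⟩ := exists_of_collapse_ne_zero hu
    exact hN t D ht
  · intro D u hu
    obtain ⟨t, ht, x, hx, rfl⟩ := exists_of_collapse_ne_zero hu
    exact ⟨t, ht, x.1, rfl⟩

theorem FstBdd.of_le {E E' : Lat K → Tri K →₀ M} {r : ℕ} {h : Fin r → K × K} (hE : FstBdd E h)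
    (hE' : ∀ D u, E' D u ≠ 0 → ∃ t, E D t ≠ 0 ∧ ∃ i, u.1 = t.1 + latNat K i) : FstBdd E' h := by
  intro D u hu
  obtain ⟨t, ht, j, hj⟩ := hE' D u hu
  obtain ⟨i, k, hk⟩ := hE D t ht
  refine ⟨i, k + j, ?_⟩
  rw [hj, AddSubgroup.coe_add, hk, coe_latNat, natPair_add, add_assoc]

theorem TriBdd.exists_third {E : Lat K → Tri K →₀ M} (hE : TriBdd E) :
    ∃ S : Finset (Lat K), ∀ D t, E D t ≠ 0 → ∃ N, t.2.2 - latNat K N ∈ S := by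
  classical
  obtain ⟨S, hS⟩ := hE
  refine ⟨S.image fun s => s.2.2, fun D t ht => ?_⟩
  obtain ⟨s, hs, i, j, k, rfl⟩ := hS D t ht
  refine ⟨k, ?_⟩
  rw [add_sub_cancel_right]
  exact Finset.mem_image_of_mem (fun s : Tri K => s.2.2) hs

theorem TriBdd.sum_ofSeries {ι : Type*} [Fintype ι] (κ : ι → Lat K)
    (f : ι → Lat K → Lat K → M) (hf : ∀ j, SerBdd (f j)) :
    TriBdd (fun D => ∑ j, ofSeries (κ j) (hf j) D) := by
  classical
  have hf' := hf
  choose S hS using hf'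
  refine ⟨Finset.univ.biUnion fun j => (S j).image fun s => (s.1, s.2, κ j), fun D t ht => ?_⟩
  rw [Finsupp.finsetSum_apply] at ht
  obtain ⟨j, -, hj⟩ := Finset.exists_ne_zero_of_sum_ne_zero ht
  obtain ⟨h1, h2, h3⟩ := ofSeries_ne_zero hj
  obtain ⟨s, hs, i, l, hi, hl⟩ := hS j _ _ h3
  refine ⟨_, Finset.mem_biUnion.2 ⟨j, Finset.mem_univ _, Finset.mem_image_of_mem _ hs⟩,
    i, l, 0, ?_⟩
  rw [map_zero, add_zero]
  exact Prod.ext hi (Prod.ext hl h1)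

theorem isHomog_sum_ofSeries {ι : Type*} [Fintype ι] (κ : ι → Lat K)
    (f : ι → Lat K → Lat K → M) (hf : ∀ j, SerBdd (f j)) (D : Lat K) :
    IsHomog D (∑ j, ofSeries (κ j) (hf j) D) := by
  intro t ht
  rw [Finsupp.finsetSum_apply] at ht
  obtain ⟨j, -, hj⟩ := Finset.exists_ne_zero_of_sum_ne_zero ht
  exact isHomog_ofSeries _ _ _ t hj

/-- The coefficient series of the power `κ` of the third variable. -/
theorem TriBdd.serBdd {E : Lat K → Tri K →₀ M} (hE : TriBdd E) (κ : Lat K) (g : Lat K → Lat K → K) :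
    SerBdd (fun P Q => g P Q • E (P + Q + κ) (P, Q, κ)) := by
  classical
  obtain ⟨S, hS⟩ := hE
  refine ⟨S.image fun s => (s.1, s.2.1), fun P Q h => ?_⟩
  obtain ⟨s, hs, i, j, k, e⟩ := hS _ _ (right_ne_zero_of_smul h)
  rw [Prod.ext_iff, Prod.ext_iff] at e
  exact ⟨_, Finset.mem_image_of_mem _ hs, i, j, e.1, e.2.1⟩

theorem TriBdd.swap₁₃ {E : Lat K → Tri K →₀ M} (hE : TriBdd E) :
    TriBdd (fun D => permTri (K := K) (swap₁₃ K) (E D)) := by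
  classical
  obtain ⟨S, hS⟩ := hE
  refine ⟨S.image (OPEAlg.swap₁₃ K), fun D t ht => ?_⟩
  obtain ⟨s, hs, i, j, k, e⟩ := hS D _ ht
  refine ⟨_, Finset.mem_image_of_mem _ hs, k, j, i, ?_⟩
  rw [Equiv.symm_apply_eq] at e
  exact e

theorem TriBdd.smul {E : Lat K → Tri K →₀ M} (hE : TriBdd E) (g : Lat K → K) :
    TriBdd (fun D => g D • E D) := by
  obtain ⟨S, hS⟩ := hE
  refine ⟨S, fun D t ht => hS D t ?_⟩
  rw [Finsupp.smul_apply] at ht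
  exact right_ne_zero_of_smul ht

end Representatives

/-! ### Duality in terms of representing families. -/

section Duality

variable {K V M : Type*} [Field K] [CharZero K] [AddCommGroup V] [Module K V]
  [AddCommGroup M] [Module K M] {𝒱 : ZMod 2 → Submodule K V} {ℳ : ZMod 2 → Submodule K M}

theorem CheckFoldModule.mem_lat_of_prod_ne_zero (Y : CheckFoldModule 𝒱 ℳ) {n : K × K} {a : V}
    {c : M} (h : Y.prod n a c ≠ 0) : n ∈ Lat K := by
  by_contra hn
  exact h (by rw [Y.prod_eq_zero n hn]; rfl)

theorem latSupported_iterProd (YV : CheckFoldAlgebra 𝒱) (YM : CheckFoldModule 𝒱 ℳ) (a b : V)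
    (c : M) : LatSupported (iterProd YV YM a b c) := by
  intro n m h
  refine ⟨YV.mem_lat_of_prod_ne_zero (a := a) (c := b) fun h0 => h ?_,
    YM.mem_lat_of_prod_ne_zero h⟩
  rw [iterProd, h0, map_zero, LinearMap.zero_apply]

theorem latSupported_shiftProd (YM : CheckFoldModule 𝒱 ℳ) (a b : V) (c : M) :
    LatSupported (shiftProd YM a b c) := by
  intro n m h
  obtain ⟨i, hi⟩ : ∃ i, _ ≠ _ := by
    by_contra! h0
    exact h (finsum_eq_zero_of_forall_eq_zero h0)
  have h1 := right_ne_zero_of_smul hi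
  constructor
  · exact (sub_mem_lat_iff (natPair_mem_lat i)).1 (YM.mem_lat_of_prod_ne_zero h1)
  · refine (add_mem_lat_iff (natPair_mem_lat i)).1
      (YM.mem_lat_of_prod_ne_zero (a := b) (c := c) fun h0 => h1 ?_)
    rw [h0, map_zero]

theorem exists_isRep_of_dualOn {YV : CheckFoldAlgebra 𝒱} {YM : CheckFoldModule 𝒱 ℳ} {a b : V}
    {c : M} {r s : ℕ} {h : Fin r → K × K} {k : Fin s → K × K} (H : DualOn YV YM a b c h k) :
    ∃ E, IsRep (coeff₂ (shiftProd YM a b c)) (coeff₂ (iterProd YV YM a b c)) E ∧ FstBdd E h := by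
  obtain ⟨-, hk, d, ⟨hd, h1, h2⟩, hb⟩ := H
  let κ : Fin s → Lat K := fun j => -⟨k j, hk j⟩
  have hκ : ∀ j, -k j = (κ j : K × K) := fun j => rfl
  refine ⟨fun D => ∑ j, ofSeries (κ j) (serBdd_coeff₂ (hd j)) D,
    ⟨isHomog_sum_ofSeries _ _ _, TriBdd.sum_ofSeries _ _ _, fun D Q => ?_, fun D P => ?_⟩, ?_⟩
  · rw [h1, coeff₂_sum, map_sum, Finset.sum_apply]
    refine Finset.sum_congr rfl fun j _ => ?_
    rw [hκ, coeff₂_mulPowFst_one, expand_ofSeries, sub_add_cancel]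
  · rw [h2, coeff₂_sum, map_sum, map_sum, Finset.sum_apply]
    refine Finset.sum_congr rfl fun j _ => ?_
    rw [hκ, coeff₂_mulPowSnd_one, expand_swap₁₂_ofSeries, add_sub_cancel]
  · intro D t ht
    rw [Finsupp.finsetSum_apply] at ht
    obtain ⟨j, -, hj⟩ := Finset.exists_ne_zero_of_sum_ne_zero ht
    obtain ⟨-, -, h3⟩ := ofSeries_ne_zero hj
    obtain ⟨i, l, hi⟩ := hb j (-(t.1 : K × K) - 1) fun h0 => h3 (congrFun h0 _)
    refine ⟨i, l, ?_⟩
    linear_combination (exp := 1) -hi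

/-- After the third exponents are collapsed to a finite set, each of them yields one dual pole
order, and its coefficients in all degrees assemble to one numerator. -/
theorem exists_dualOn_of_isRep {YV : CheckFoldAlgebra 𝒱} {YM : CheckFoldModule 𝒱 ℳ} {a b : V}
    {c : M} {r : ℕ} {h : Fin r → K × K} (hh : ∀ i, h i ∈ checkK K) {E : Lat K → Tri K →₀ M}
    (hE : IsRep (coeff₂ (shiftProd YM a b c)) (coeff₂ (iterProd YV YM a b c)) E)
    (hx : FstBdd E h) : ∃ (s : ℕ) (k : Fin s → K × K), DualOn YV YM a b c h k := by
  obtain ⟨S, hS⟩ := hE.bdd.exists_third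
  obtain ⟨E', hE', hb', he', hS', hle⟩ := exists_collapse hE.homog hE.bdd S hS
  have hR := hE.congr hE' hb' he'
  have hx' := hx.of_le hle
  let κ : Fin S.card → Lat K := fun j => S.equivFin.symm j
  let f : Lat K → Lat K → Lat K → M := fun κ P Q => sg κ • E' (P + Q + κ) (P, Q, κ)
  have hf : ∀ κ, SerBdd (f κ) := fun κ => hb'.serBdd κ fun _ _ => sg κ
  have hκ : ∀ j, -(-(κ j) : K × K) = (κ j : K × K) := fun j => neg_neg _
  refine ⟨S.card, fun j => -(κ j : K × K), hh, fun j => (-(κ j)).2,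
    fun j => toDist (f (κ j)), ⟨fun j => isVertexSeries₂_toDist (hf _), ?_, ?_⟩, ?_⟩
  · refine (latSupported_shiftProd YM a b c).ext
      (LatSupported.sum fun j _ => (latSupported_toDist _).mulPowFst 1 ?_) ?_
    · rw [hκ]; exact (κ j).2
    · funext P Q
      have h1 := hR.fst (P + Q) Q
      rw [add_sub_cancel_right] at h1
      rw [← h1, coeff₂_sum, expand_of_third_mem (hE' _) S (hS' _), ← S.sum_coe_sort,
        ← S.equivFin.symm.sum_comp]
      refine Finset.sum_congr rfl fun j _ => ?_
      rw [hκ, coeff₂_mulPowFst_one, coeff₂_toDist]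
      congr 1
      funext B
      simp only [f]
      rw [sub_add_cancel, sub_add_cancel]
  · refine (latSupported_iterProd YV YM a b c).ext
      (LatSupported.sum fun j _ => (latSupported_toDist _).mulPowSnd 1 ?_) ?_
    · rw [hκ]; exact (κ j).2
    · funext P Q
      have h1 := hR.snd (P + Q) P
      rw [add_sub_cancel_left] at h1
      rw [← h1, coeff₂_sum,
        expand_of_third_mem (hE' _).swap₁₂ S (fun t ht => hS' _ ((swap₁₂ K).symm t) ht),
        ← S.sum_coe_sort, ← S.equivFin.symm.sum_comp]
      refine Finset.sum_congr rfl fun j _ => ?_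
      rw [hκ, coeff₂_mulPowSnd_one, coeff₂_toDist]
      congr 1
      funext A
      simp only [f]
      rw [add_sub_cancel, sub_add_cancel]
      rfl
  · intro j n hn
    obtain ⟨m, hm⟩ := Function.ne_iff.1 hn
    change toDist (f (κ j)) n m ≠ 0 at hm
    have hmem := latSupported_toDist _ n m hm
    rw [toDist, dif_pos hmem] at hm
    obtain ⟨i, k, hk⟩ := hx' _ _ (right_ne_zero_of_smul hm)
    refine ⟨i, k, ?_⟩
    push_cast at hk
    rw [coe_latOne] at hk
    linear_combination (exp := 1) -hk

theorem dualOfOrdersAtMost_iff {YV : CheckFoldAlgebra 𝒱} {YM : CheckFoldModule 𝒱 ℳ} {a b : V}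
    {r : ℕ} {h : Fin r → K × K} (hh : ∀ i, h i ∈ checkK K) : DualOfOrdersAtMost YV YM a b h ↔
      ∀ c, ∃ E, IsRep (coeff₂ (shiftProd YM a b c)) (coeff₂ (iterProd YV YM a b c)) E ∧
        FstBdd E h := by
  constructor
  · intro H c
    obtain ⟨s, k, H⟩ := H c
    exact exists_isRep_of_dualOn H
  · intro H c
    obtain ⟨E, hE, hx⟩ := H c
    exact exists_dualOn_of_isRep hh hE hx

end Duality

/-! ### Skew-symmetry as a permutation of the variables. -/

section Skew

variable {K V M : Type*} [Field K] [CharZero K] [AddCommGroup V] [Module K V]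
  [AddCommGroup M] [Module K M] {𝒱 : ZMod 2 → Submodule K V} {ℳ : ZMod 2 → Submodule K M}

theorem IsVertexSeries.finite {W : Type*} [AddCommGroup W] {f : Dist K W} (hf : IsVertexSeries f)
    (n : K × K) : {i | f (n + natPair K i) ≠ 0}.Finite := by
  obtain ⟨r, h, hf⟩ := hf
  have hfin : ∀ j, {i : ℕ × ℕ | ∃ k, n + natPair K i = h j - 1 - natPair K k}.Finite := by
    intro j
    by_cases hl : ∃ l, natPair K l = h j - 1 - n
    · obtain ⟨l, hl⟩ := hl
      refine (Finset.Iic l).finite_toSet.subset ?_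
      rintro i ⟨k, hk⟩
      rw [Finset.mem_coe, Finset.mem_Iic]
      have : l = i + k := natPair_injective (K := K) (by
        rw [natPair_add, hl]
        linear_combination (exp := 1) -hk)
      rw [this]
      exact le_self_add
    · convert Set.finite_empty (α := ℕ × ℕ)
      refine Set.eq_empty_of_forall_notMem ?_
      rintro i ⟨k, hk⟩
      refine hl ⟨i + k, ?_⟩
      rw [natPair_add]
      linear_combination (exp := 1) hk
  refine (Set.finite_iUnion hfin).subset fun i hi => ?_
  obtain ⟨j, k, hk⟩ := hf _ hi
  exact Set.mem_iUnion.2 ⟨j, k, hk⟩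

theorem IsVertexSeries.bddBelowOn {W : Type*} [AddCommGroup W] {f : Dist K W}
    (hf : IsVertexSeries f) {g : Lat K → M}
    (hg : ∀ A : Lat K, g A ≠ 0 → f (-(A : K × K) - 1) ≠ 0) : BddBelowOn g := by
  intro Q
  refine (hf.finite (-(Q : K × K) - 1)).subset fun i hi => ?_
  convert hg _ hi using 3
  push_cast
  rw [coe_latNat]
  abel

theorem bddBelowOn_iterProd {YV : CheckFoldAlgebra 𝒱} (hYV : YV.IsBounded)
    (YM : CheckFoldModule 𝒱 ℳ) (a b : V) (c : M) (D : Lat K) :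
    BddBelowOn (fun A => coeff₂ (iterProd YV YM a b c) A (D - A)) := by
  refine (hYV a b).bddBelowOn fun A hA h0 => hA ?_
  rw [coeff₂, iterProd, h0, map_zero, LinearMap.zero_apply]

theorem prod_pow_fst {YM : CheckFoldModule 𝒱 ℳ} {T T' : V →ₗ[K] V}
    (hT : IsTranslationEndomorphism YM T T') (u : V) (c : M) (m : K × K) (i : ℕ) :
    YM.prod m ((T ^ i) u) c = ((-1) ^ i * ∏ j ∈ Finset.range i, (m.1 - (j : K))) •
      YM.prod (m - ((i : K), 0)) u c := by
  induction i generalizing u with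
  | zero => simp [Prod.mk_zero_zero]
  | succ i ih =>
    have e : m - ((i : K), 0) - (1, 0) = m - (((i + 1 : ℕ) : K), 0) := by
      ext <;> simp [sub_sub]
    rw [pow_succ, Module.End.mul_apply, ih, (hT u c _).1, Finset.prod_range_succ, ← neg_smul,
      smul_smul, e]
    congr 1
    simp only [Prod.fst_sub]
    ring

theorem prod_pow_snd {YM : CheckFoldModule 𝒱 ℳ} {T T' : V →ₗ[K] V}
    (hT : IsTranslationEndomorphism YM T T') (u : V) (c : M) (m : K × K) (i : ℕ) :
    YM.prod m ((T' ^ i) u) c = ((-1) ^ i * ∏ j ∈ Finset.range i, (m.2 - (j : K))) •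
      YM.prod (m - (0, (i : K))) u c := by
  induction i generalizing u with
  | zero => simp [Prod.mk_zero_zero]
  | succ i ih =>
    have e : m - (0, (i : K)) - (0, 1) = m - (0, ((i + 1 : ℕ) : K)) := by
      ext <;> simp [sub_sub]
    rw [pow_succ, Module.End.mul_apply, ih, (hT u c _).2, Finset.prod_range_succ, ← neg_smul,
      smul_smul, e]
    congr 1
    simp only [Prod.snd_sub]
    ring

/-- The operators act as `∂_z` and `∂_z̄`, so divided powers produce binomial coefficients of the
mode index. -/
theorem prod_divPow {YM : CheckFoldModule 𝒱 ℳ} {T T' : V →ₗ[K] V}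
    (hT : IsTranslationEndomorphism YM T T') (u : V) (c : M) (m : K × K) (i : ℕ × ℕ) :
    YM.prod m (divPow T i.1 (divPow T' i.2 u)) c = (natSign K i * binom₂ m i) •
      YM.prod (m - natPair K i) u c := by
  have e : m - ((i.1 : K), 0) - (0, (i.2 : K)) = m - natPair K i := by
    ext <;> simp [natPair]
  simp only [divPow, LinearMap.smul_apply, map_smul]
  rw [prod_pow_fst hT, prod_pow_snd hT, e, smul_smul, smul_smul, smul_smul]
  congr 1
  simp only [natSign, binom₂, binom, pow_add, Prod.snd_sub, sub_zero]
  ring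

theorem superSign_mul_self (p q : ZMod 2) : superSign K p q * superSign K p q = 1 := by
  rw [superSign, ← mul_pow]
  simp

/-- Skew-symmetry as a relation between the iterated products on `M`. -/
theorem superSign_smul_iterProd {YV : CheckFoldAlgebra 𝒱} {YM : CheckFoldModule 𝒱 ℳ}
    {T T' : V →ₗ[K] V} (hT : IsTranslationEndomorphism YM T T') {p q : ZMod 2} {a b : V}
    (hskew : SkewSymmetric YV T T' p q a b) (c : M) (D P : Lat K) :
    superSign K p q • coeff₂ (iterProd YV YM b a c) P (D - P) =
      sg D • triOp (shWt D) (fun A => coeff₂ (iterProd YV YM a b c) A (D - A)) P := by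
  set n : K × K := -(P : K × K) - 1 with hn
  set m : K × K := -((D - P : Lat K) : K × K) - 1 with hm
  have hnl : n ∈ checkK K := (-P - latOne K).2
  have hsn : checkSign n = sg P := by
    have : checkSign n = sg (-P - latOne K) := rfl
    rw [this, sg_sub, sg_neg, sg_latOne, mul_one]
  let L : V →ₗ[K] M := (YM.prod m).flip c
  have hL : superSign K p q • coeff₂ (iterProd YV YM b a c) P (D - P) =
      L (superSign K p q • YV.prod n b a) := by
    rw [map_smul]
    rfl
  rw [hL, hskew.2 n hnl, map_finsum L, triOp, smul_finsum]
  · refine finsum_congr fun i => ?_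
    rw [map_smul, smul_smul]
    change _ • YM.prod m (divPow T i.1 (divPow T' i.2 (YV.prod (n + natPair K i) a b))) c = _
    rw [prod_divPow hT, smul_smul, coeff₂, iterProd, shWt]
    have e : D - (P - latNat K i) = D - P + latNat K i := by abel
    congr 1
    · rw [hm, binom₂_neg_sub_one, hsn, e, AddSubgroup.coe_add, coe_latNat, sg_add, sg_sub,
        sg_latNat]
      change sg P * natSign K i * _ = _
      linear_combination (sg P * natSign K i * binom₂ (((D - P : Lat K) : K × K) + natPair K i) i) *
        (natSign_mul_self (K := K) i) - (sg P * natSign K i *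
        binom₂ (((D - P : Lat K) : K × K) + natPair K i) i) * sg_mul_self D
    · have e1 : m - natPair K i = -((D - (P - latNat K i) : Lat K) : K × K) - 1 := by
        rw [hm]
        push_cast
        rw [coe_latNat]
        abel
      have e2 : n + natPair K i = -((P - latNat K i : Lat K) : K × K) - 1 := by
        rw [hn]
        push_cast
        rw [coe_latNat]
        abel
      rw [e1, e2]
  · refine (hskew.1.finite n).subset fun i hi h0 => hi ?_
    beta_reduce
    rw [h0, map_zero, map_zero, smul_zero]

variable {F G F' G' : Lat K → Lat K → M} {E E' : Lat K → Tri K →₀ M}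

/-- The exchange of the last two variables. -/
def swap₂₃ (K : Type*) [Field K] : Tri K ≃ Tri K where
  toFun t := (t.1, t.2.2, t.2.1)
  invFun t := (t.1, t.2.2, t.2.1)
  left_inv _ := rfl
  right_inv _ := rfl

theorem permTri_swap₁₂_swap₂₃ (e : Tri K →₀ M) :
    permTri (K := K) (swap₁₂ K) (permTri (K := K) (swap₂₃ K) e) =
      permTri (K := K) (swap₁₃ K) (permTri (K := K) (swap₁₂ K) e) := by
  ext t
  rfl

theorem permTri_swap₁₃_swap₂₃ (e : Tri K →₀ M) :
    permTri (K := K) (swap₁₃ K) (permTri (K := K) (swap₂₃ K) e) =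
      permTri (K := K) (swap₁₂ K) (permTri (K := K) (swap₁₃ K) e) := by
  ext t
  rfl

theorem IsHomog.swap₂₃ {D : Lat K} {e : Tri K →₀ M} (h : IsHomog D e) :
    IsHomog D (permTri (K := K) (swap₂₃ K) e) := by
  intro t ht
  rw [← h _ ht]
  simp only [triDeg, OPEAlg.swap₂₃, Equiv.coe_fn_symm_mk]
  abel

theorem TriBdd.swap₂₃ (hE : TriBdd E) :
    TriBdd (fun D => permTri (K := K) (swap₂₃ K) (E D)) := by
  classical
  obtain ⟨S, hS⟩ := hE
  refine ⟨S.image (OPEAlg.swap₂₃ K), fun D t ht => ?_⟩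
  obtain ⟨s, hs, i, j, k, e⟩ := hS D _ ht
  refine ⟨_, Finset.mem_image_of_mem _ hs, i, k, j, ?_⟩
  rw [Equiv.symm_apply_eq] at e
  exact e

/-- Skew-symmetry turns the sums of monomials of `a, b` into those of `b, a`. -/
theorem IsRep.skew {ε : K} (hε : ε * ε = 1) (hE : IsRep F G E) (hE' : IsRep F' G' E')
    (hskew : ∀ D P, ε • G' P (D - P) = sg D • triOp (shWt D) (fun A => G A (D - A)) P) :
    IsRep F' G' (fun D => (ε * sg D) • permTri (K := K) (swap₂₃ K) (E D)) := by
  have hh : ∀ D, IsHomog D ((ε * sg D) • permTri (K := K) (swap₂₃ K) (E D)) :=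
    fun D => (hE.homog D).swap₂₃.smul _
  have hs : ∀ D, expand (permTri (K := K) (swap₁₂ K)
      ((ε * sg D) • permTri (K := K) (swap₂₃ K) (E D))) =
      expand (permTri (K := K) (swap₁₂ K) (E' D)) := by
    intro D
    funext P
    rw [map_smul, permTri_swap₁₂_swap₂₃, map_smul, ← triOp_shWt_expand (hE.homog D).swap₁₂,
      hE'.snd, Pi.smul_apply, mul_smul]
    have : expand (permTri (K := K) (swap₁₂ K) (E D)) = fun A => G A (D - A) :=
      funext (hE.snd D)
    rw [this, ← hskew, smul_smul, hε, one_smul]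
  refine hE'.congr hh (hE.bdd.swap₂₃.smul fun D => ε * sg D) fun D => ?_
  -- By `hs` the two families agree for `v > u`; the exchange principle, applied after swapping the
  -- first two variables, transports this to `u > v`. This is where duality of `b, a` enters,
  -- through `hE'`.
  have := expand_swap₁₂_congr (hh D).swap₁₂ (hE'.homog D).swap₁₂ (hs D)
  rwa [permTri_swap₁₂_swap₁₂, permTri_swap₁₂_swap₁₂] at this

/-- The substitution is an involution and the signs square to one, so the relation for `a, b` gives
the one for `b, a`. -/
theorem skew_symm {ε : K} (hε : ε * ε = 1) (hG : ∀ D, BddBelowOn (fun A => G A (D - A)))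
    (hskew : ∀ D P, ε • G' P (D - P) = sg D • triOp (shWt D) (fun A => G A (D - A)) P)
    (D P : Lat K) : ε • G P (D - P) = sg D • triOp (shWt D) (fun A => G' A (D - A)) P := by
  have h : (fun A => G' A (D - A)) =
      fun P => (ε * sg D) • triOp (shWt D) (fun A => G A (D - A)) P := by
    funext P
    rw [mul_smul, ← hskew, smul_smul, hε, one_smul]
  rw [h, triOp_smul, triOp_shWt_shWt (hG D), smul_smul, mul_left_comm, sg_mul_self, mul_one]

theorem FstBdd.skew {r : ℕ} {h : Fin r → K × K} (hE : FstBdd E h) (g : Lat K → K) :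
    FstBdd (fun D => g D • permTri (K := K) (swap₂₃ K) (E D)) h := by
  intro D t ht
  rw [Finsupp.smul_apply] at ht
  exact hE D ((swap₂₃ K).symm t) (right_ne_zero_of_smul ht)

/-- The shifted product is obtained from the product `a(ž) b(w̌) c` by substitution. -/
theorem coeff₂_shiftProd (YM : CheckFoldModule 𝒱 ℳ) (a b : V) (c : M) (D Q : Lat K) :
    coeff₂ (shiftProd YM a b c) (D - Q) Q = triOp (shWt D)
      (fun Q => sg (D - Q) • coeff₂ (juxt (YM.field a) (YM.field b) c) (D - Q) Q) Q := by
  rw [coeff₂, shiftProd, triOp]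
  refine finsum_congr fun i => ?_
  rw [smul_smul, shWt]
  have e : D - (Q - latNat K i) = D - Q + latNat K i := by abel
  have e1 : -((D - Q : Lat K) : K × K) - 1 - natPair K i =
      -((D - (Q - latNat K i) : Lat K) : K × K) - 1 := by
    rw [e]
    push_cast
    rw [coe_latNat]
    abel
  have e2 : -(Q : K × K) - 1 + natPair K i = -((Q - latNat K i : Lat K) : K × K) - 1 := by
    push_cast
    rw [coe_latNat]
    abel
  rw [mul_right_comm, sg_mul_self, one_mul, e1, e2, neg_sub, sub_neg_eq_add, add_sub_cancel_left]
  rfl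

theorem bddBelowOn_juxt {YM : CheckFoldModule 𝒱 ℳ} (hYM : YM.IsBounded) (a b : V) (c : M)
    (D : Lat K) : BddBelowOn
      (fun Q => sg (D - Q) • coeff₂ (juxt (YM.field a) (YM.field b) c) (D - Q) Q) := by
  refine (hYM b c).bddBelowOn fun Q hQ h0 => hQ ?_
  have : coeff₂ (juxt (YM.field a) (YM.field b) c) (D - Q) Q =
    YM.prod (-((D - Q : Lat K) : K × K) - 1) a (YM.prod (-(Q : K × K) - 1) b c) := rfl
  rw [this, h0, map_zero, smul_zero]

/-- After the exchange the first variable is `-ž`, hence the sign, and the third is `ž - w̌`.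
Boundedness of `M` makes the substitution that defines the shifted product invertible. -/
theorem expand_swap₁₃_of_isRep {YM : CheckFoldModule 𝒱 ℳ} (hYM : YM.IsBounded) {a b : V} {c : M}
    (hE : IsRep (coeff₂ (shiftProd YM a b c)) G E) (D Q : Lat K) :
    expand (permTri (K := K) (swap₁₃ K) (E D)) Q =
      sg (D - Q) • coeff₂ (juxt (YM.field a) (YM.field b) c) (D - Q) Q := by
  have : expand (E D) = triOp (shWt D)
      (fun Q => sg (D - Q) • coeff₂ (juxt (YM.field a) (YM.field b) c) (D - Q) Q) := by
    funext Q
    rw [hE.fst, coeff₂_shiftProd]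
  rw [← triOp_shWt_expand (hE.homog D), this, triOp_shWt_shWt (bddBelowOn_juxt hYM a b c D)]

/-- Reading the skewed family as a representative for `b, a` identifies the expansion for `w > z`
with the opposite product, since exchanging the last two variables and then the first and third
equals exchanging the first and third and then the first two. -/
theorem expand_swap₁₂_swap₁₃_of_isRep {YM : CheckFoldModule 𝒱 ℳ} (hYM : YM.IsBounded) {a b : V}
    {c : M} {ε : K} (hε : ε * ε = 1)
    (hE : IsRep (coeff₂ (shiftProd YM b a c)) G
      (fun D => (ε * sg D) • permTri (K := K) (swap₂₃ K) (E D))) (D P : Lat K) :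
    expand (permTri (K := K) (swap₁₂ K) (permTri (K := K) (swap₁₃ K) (E D))) P =
      (ε * sg P) • coeff₂ (juxtOpp (YM.field a) (YM.field b) c) P (D - P) := by
  have h := expand_swap₁₃_of_isRep hYM hE D P
  rw [map_smul, map_smul, permTri_swap₁₃_swap₂₃, Pi.smul_apply] at h
  have h2 := congrArg (fun x => (ε * sg D) • x) h
  simp only [smul_smul] at h2
  have h3 : ε * sg D * (ε * sg D) = 1 := by
    linear_combination hε * (sg D * sg D) + sg_mul_self D
  have h4 : ε * sg D * sg (D - P) = ε * sg P := by
    rw [sg_sub]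
    linear_combination (ε * sg P) * sg_mul_self D
  rw [h3, one_smul, h4] at h2
  exact h2

end Skew

/-! ### Linearity and composition of multiplication by powers. -/

section Multiplication

variable {K M : Type*} [Field K] [CharZero K] [AddCommGroup M] [Module K M]

theorem IsVertexSeries₂.fst {d : Dist₂ K M} (hd : IsVertexSeries₂ d) :
    IsVertexSeries (fun n m => d n m : Dist K (Dist K M)) := by
  obtain ⟨r, h, h', hd⟩ := hd
  refine ⟨r, h, fun n hn => ?_⟩
  obtain ⟨m, hm⟩ := Function.ne_iff.1 hn
  obtain ⟨i, k, -, e, -⟩ := hd n m hm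
  exact ⟨i, k, e⟩

theorem IsVertexSeries₂.snd {d : Dist₂ K M} (hd : IsVertexSeries₂ d) :
    IsVertexSeries (fun m n => d n m : Dist K (Dist K M)) := by
  obtain ⟨r, h, h', hd⟩ := hd
  refine ⟨r, h', fun m hm => ?_⟩
  obtain ⟨n, hn⟩ := Function.ne_iff.1 hm
  obtain ⟨i, -, k, -, e⟩ := hd n m hn
  exact ⟨i, k, e⟩

theorem mulPowFst_sum {ι : Type*} (s : Finset ι) (x : ι → K) {d : ι → Dist₂ K M}
    (hd : ∀ j, IsVertexSeries₂ (d j)) (ν : K) (k : K × K) :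
    mulPowFst ν k (∑ j ∈ s, x j • d j) = ∑ j ∈ s, x j • mulPowFst ν k (d j) := by
  funext n m
  simp only [mulPowFst, Finset.sum_apply, Pi.smul_apply, smul_finsum, Finset.smul_sum]
  rw [finsum_sum_comm]
  · exact Finset.sum_congr rfl fun j _ => finsum_congr fun i => smul_comm _ _ _
  · intro j _
    refine ((hd j).snd.finite m).subset fun i hi h0 => hi ?_
    beta_reduce
    rw [show d j _ (m + natPair K i) = 0 from congrFun h0 _, smul_zero, smul_zero]

theorem mulPowSubOpp_sum {ι : Type*} (s : Finset ι) (x : ι → K) {d : ι → Dist₂ K M}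
    (hd : ∀ j, IsVertexSeries₂ (d j)) (k : K × K) :
    mulPowSubOpp k (∑ j ∈ s, x j • d j) = ∑ j ∈ s, x j • mulPowSubOpp k (d j) := by
  funext n m
  simp only [mulPowSubOpp, mulPowSnd, Finset.sum_apply, Pi.smul_apply, smul_finsum,
    Finset.smul_sum]
  rw [finsum_sum_comm]
  · exact Finset.sum_congr rfl fun j _ => finsum_congr fun i => by
      rw [smul_comm (x j), smul_comm (x j)]
  · intro j _
    refine ((hd j).fst.finite n).subset fun i hi h0 => hi ?_
    beta_reduce
    rw [show d j (n + natPair K i) _ = 0 from congrFun h0 _, smul_zero, smul_zero, smul_zero]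

theorem bddBelowOn_coeff₂ {d : Dist₂ K M} (hd : IsVertexSeries₂ d) (g : Lat K → K) (D : Lat K) :
    BddBelowOn (fun B => g B • coeff₂ d (D - B) B) := by
  refine hd.snd.bddBelowOn fun B hB h0 => hB ?_
  rw [show coeff₂ d (D - B) B = 0 from congrFun h0 _, smul_zero]

theorem mulPowFst_mulPowFst {d : Dist₂ K M} (hd : IsVertexSeries₂ d) (κ κ' : Lat K)
    (P Q : Lat K) :
    coeff₂ (mulPowFst (-1) (κ : K × K) (mulPowFst (-1) (κ' : K × K) d)) P Q =
      coeff₂ (mulPowFst (-1) ((κ + κ' : Lat K) : K × K) d) P Q := by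
  rw [coeff₂_mulPowFst_neg_one, coeff₂_mulPowFst_neg_one,
    ← triOp_mulWt_mulWt (bddBelowOn_coeff₂ hd _ _)]
  have : (fun B => sg (P + Q - κ - B) •
      coeff₂ (mulPowFst (-1) (κ' : K × K) d) (P + Q - κ - B) B) =
      fun B => sg κ' • triOp (mulWt κ')
        (fun B => sg (P + Q - (κ + κ') - B) • coeff₂ d (P + Q - (κ + κ') - B) B) B := by
    funext B
    rw [coeff₂_mulPowFst_neg_one, smul_smul, ← mul_assoc, sg_mul_self, one_mul, sub_add_cancel,
      sub_sub (P + Q)]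
  rw [this, triOp_smul, smul_smul, sg_add, mul_assoc]

theorem SerBdd.smul {f : Lat K → Lat K → M} (hf : SerBdd f) (g : Lat K → Lat K → K) :
    SerBdd (fun P Q => g P Q • f P Q) := by
  obtain ⟨S, hS⟩ := hf
  exact ⟨S, fun P Q h => hS P Q (right_ne_zero_of_smul h)⟩

theorem SerBdd.sum {ι : Type*} {s : Finset ι} {f : ι → Lat K → Lat K → M}
    (hf : ∀ j, SerBdd (f j)) : SerBdd (fun P Q => ∑ j ∈ s, f j P Q) := by
  classical
  choose S hS using hf
  refine ⟨s.biUnion S, fun P Q h => ?_⟩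
  obtain ⟨j, hj, h⟩ := Finset.exists_ne_zero_of_sum_ne_zero h
  obtain ⟨x, hx, h⟩ := hS j P Q h
  exact ⟨x, Finset.mem_biUnion.2 ⟨j, hj, hx⟩, h⟩

theorem isVertexSeries₂_sum {ι : Type*} (s : Finset ι) (x : ι → K) {d : ι → Dist₂ K M}
    (hd : ∀ j, IsVertexSeries₂ (d j)) (hl : ∀ j, LatSupported (d j)) :
    IsVertexSeries₂ (∑ j ∈ s, x j • d j) := by
  have h : LatSupported (∑ j ∈ s, x j • d j) := LatSupported.sum fun j _ => (hl j).smul _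
  rw [h.ext (latSupported_toDist _) (coeff₂_toDist _).symm]
  refine isVertexSeries₂_toDist ?_
  have : coeff₂ (∑ j ∈ s, x j • d j) = fun P Q => ∑ j ∈ s, x j • coeff₂ (d j) P Q := by
    funext P Q
    rw [coeff₂_sum]
    rfl
  rw [this]
  exact SerBdd.sum fun j => (serBdd_coeff₂ (hd j)).smul fun _ _ => x j

end Multiplication

/-! ### From representing families to operator product expansions and back. -/

section Locality

variable {K V M : Type*} [Field K] [CharZero K] [AddCommGroup V] [Module K V]
  [AddCommGroup M] [Module K M] {𝒱 : ZMod 2 → Submodule K V} {ℳ : ZMod 2 → Submodule K M}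

theorem latSupported_juxt (YM : CheckFoldModule 𝒱 ℳ) (a b : V) (c : M) :
    LatSupported (juxt (YM.field a) (YM.field b) c) := by
  intro n m h
  refine ⟨YM.mem_lat_of_prod_ne_zero h, YM.mem_lat_of_prod_ne_zero (a := b) (c := c) fun h0 => h ?_⟩
  change YM.prod n a (YM.prod m b c) = 0
  rw [h0, map_zero]

theorem latSupported_juxtOpp (YM : CheckFoldModule 𝒱 ℳ) (a b : V) (c : M) :
    LatSupported (juxtOpp (YM.field a) (YM.field b) c) := fun n m h =>
  (latSupported_juxt YM b a c m n h).symm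

theorem expand_swap₁₃_congr {D : Lat K} {e e' : Tri K →₀ M} (he : IsHomog D e)
    (he' : IsHomog D e') (h : expand e = expand e') :
    expand (permTri (K := K) (swap₁₃ K) e) = expand (permTri (K := K) (swap₁₃ K) e') := by
  rw [← triOp_shWt_expand he, ← triOp_shWt_expand he', h]

/-- Locality on a single vector. -/
theorem exists_ope_of_isRep {YM : CheckFoldModule 𝒱 ℳ} (hYM : YM.IsBounded) {a b : V} {c : M}
    {ε : K} (hε : ε * ε = 1) {G G' : Lat K → Lat K → M} {E : Lat K → Tri K →₀ M}
    (hE : IsRep (coeff₂ (shiftProd YM a b c)) G E)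
    (hE' : IsRep (coeff₂ (shiftProd YM b a c)) G'
      (fun D => (ε * sg D) • permTri (K := K) (swap₂₃ K) (E D)))
    {r : ℕ} {h : Fin r → K × K} (hh : ∀ i, h i ∈ checkK K) (hinj : Function.Injective h)
    (hx : FstBdd E h) : ∃ d : Fin r → Dist₂ K M, (∀ i, LatSupported (d i)) ∧
      (∀ i, IsVertexSeries₂ (d i)) ∧
      juxt (YM.field a) (YM.field b) c = ∑ i, mulPowFst (-1) (-h i) (d i) ∧
      ε • juxtOpp (YM.field a) (YM.field b) c = ∑ i, mulPowSubOpp (-h i) (d i) := by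
  classical
  let κ : Fin r → Lat K := fun i => -⟨h i, hh i⟩
  have hκ : ∀ j, -h j = (κ j : K × K) := fun j => rfl
  have hκinj : Function.Injective κ := fun i j hij =>
    hinj (congrArg Subtype.val (neg_injective hij))
  -- The exchange makes the duality bounds `-h i + ℕ²` on the first exponent into bounds on the
  -- power of `ž - w̌`, which is then collapsed to exactly `-h i`.
  obtain ⟨E₁, hE₁, hb₁, he₁, hS₁, -⟩ := exists_collapse (fun D => (hE.homog D).swap₁₃)
    hE.bdd.swap₁₃ (Finset.univ.image κ) (by
      intro D t ht
      obtain ⟨i, k, hk⟩ := hx D ((swap₁₃ K).symm t) ht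
      refine ⟨k, Finset.mem_image.2 ⟨i, Finset.mem_univ _, ?_⟩⟩
      rw [eq_sub_iff_add_eq]
      ext1
      exact hk.symm)
  -- The factor `sg P` turns powers of `-ž` back into powers of `ž`.
  let f : Fin r → Lat K → Lat K → M := fun i P Q => sg P • E₁ (P + Q + κ i) (P, Q, κ i)
  have hf : ∀ i, SerBdd (f i) := fun i => hb₁.serBdd (κ i) fun P _ => sg P
  refine ⟨fun i => toDist (f i), fun i => latSupported_toDist _,
    fun i => isVertexSeries₂_toDist (hf i), ?_, ?_⟩
  · refine (latSupported_juxt YM a b c).ext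
      (LatSupported.sum fun j _ => (latSupported_toDist _).mulPowFst (-1) ?_) ?_
    · rw [hκ]; exact (κ j).2
    · funext P Q
      have h1 := expand_swap₁₃_of_isRep hYM hE (P + Q) Q
      rw [← he₁, expand_of_third_mem (hE₁ _) _ (hS₁ _), Finset.sum_image hκinj.injOn,
        add_sub_cancel_right] at h1
      have h2 := congrArg (fun x => sg P • x) h1
      simp only [smul_smul, sg_mul_self, one_smul, Finset.smul_sum] at h2
      rw [← h2, coeff₂_sum]
      refine Finset.sum_congr rfl fun j _ => ?_
      rw [hκ, coeff₂_mulPowFst_neg_one, coeff₂_toDist, triOp_smul]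
      beta_reduce
      rw [smul_smul]
      congr 2
      funext B
      simp only [f]
      rw [sub_add_cancel, sub_add_cancel, smul_smul, sg_mul_self, one_smul]
  · refine ((latSupported_juxtOpp YM a b c).smul ε).ext
      (LatSupported.sum fun j _ => ((latSupported_toDist _).mulPowSnd (-1) ?_).smul _) ?_
    · rw [hκ]; exact (κ j).2
    · funext P Q
      have h1 := expand_swap₁₂_swap₁₃_of_isRep hYM hε hE' (P + Q) P
      rw [← expand_swap₁₂_congr (hE₁ _) (hE.homog _).swap₁₃ (he₁ _),
        expand_of_third_mem (hE₁ _).swap₁₂ _ (fun t ht => hS₁ _ ((swap₁₂ K).symm t) ht),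
        Finset.sum_image hκinj.injOn, add_sub_cancel_left] at h1
      have h2 := congrArg (fun x => sg P • x) h1
      simp only [smul_smul, mul_left_comm (sg P), sg_mul_self, mul_one, Finset.smul_sum] at h2
      rw [coeff₂_smul, ← h2, coeff₂_sum]
      refine Finset.sum_congr rfl fun j _ => ?_
      rw [hκ, coeff₂_mulPowSubOpp, coeff₂_toDist, triOp_smul]
      beta_reduce
      rw [smul_smul]
      congr 2
      funext A
      simp only [f]
      rw [add_sub_cancel, sub_add_cancel, smul_smul, sg_mul_self, one_smul]
      rfl

/-- The numerators found on single vectors need not depend linearly on the vector. They are chosen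
on a basis and extended linearly; each vector involves finitely many basis vectors, so the values
remain vertex series. -/
theorem exists_ope {YM : CheckFoldModule 𝒱 ℳ} {a b : V} {ε : K} {r : ℕ} {h : Fin r → K × K}
    (H : ∀ c : M, ∃ d : Fin r → Dist₂ K M, (∀ i, LatSupported (d i)) ∧
      (∀ i, IsVertexSeries₂ (d i)) ∧
      juxt (YM.field a) (YM.field b) c = ∑ i, mulPowFst (-1) (-h i) (d i) ∧
      ε • juxtOpp (YM.field a) (YM.field b) c = ∑ i, mulPowSubOpp (-h i) (d i)) :
    ∃ c : Fin r → (M →ₗ[K] Dist₂ K M), (∀ i v, LatSupported (c i v)) ∧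
      (∀ i v, IsVertexSeries₂ (c i v)) ∧
      (∀ v, juxt (YM.field a) (YM.field b) v = ∑ i, mulPowFst (-1) (-h i) (c i v)) ∧
      ∀ v, ε • juxtOpp (YM.field a) (YM.field b) v = ∑ i, mulPowSubOpp (-h i) (c i v) := by
  choose d hl hd h1 h2 using H
  let B := Module.Basis.ofVectorSpace K M
  have hc : ∀ i v, B.constr K (fun j => d (B j) i) v =
      ∑ j ∈ (B.repr v).support, B.repr v j • d (B j) i := fun i v => B.constr_apply _ _ _
  have hv : ∀ v, v = ∑ j ∈ (B.repr v).support, B.repr v j • B j := fun v =>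
    (B.linearCombination_repr v).symm
  refine ⟨fun i => B.constr K (fun j => d (B j) i), fun i v => ?_, fun i v => ?_, fun v => ?_,
    fun v => ?_⟩
  · rw [hc]
    exact LatSupported.sum fun j _ => (hl _ _).smul _
  · rw [hc]
    exact isVertexSeries₂_sum _ _ (fun j => hd _ _) fun j => hl _ _
  · simp only [hc]
    conv_lhs => rw [hv v]
    simp only [map_sum, map_smul]
    simp only [h1, Finset.smul_sum]
    rw [Finset.sum_comm]
    exact Finset.sum_congr rfl fun i _ => (mulPowFst_sum _ _ (fun j => hd _ _) _ _).symm
  · simp only [hc]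
    conv_lhs => rw [hv v]
    simp only [map_sum, map_smul, Finset.smul_sum, smul_comm ε]
    simp only [h2, Finset.smul_sum]
    rw [Finset.sum_comm]
    exact Finset.sum_congr rfl fun i _ => (mulPowSubOpp_sum _ _ (fun j => hd _ _) _).symm

/-- A factor `(ž - w̌)^n` of the numerators of an OPE lowers the duality orders. -/
theorem exists_isRep_of_ope {YM : CheckFoldModule 𝒱 ℳ} (hYM : YM.IsBounded) {a b : V} {c : M}
    {G : Lat K → Lat K → M} {E : Lat K → Tri K →₀ M}
    (hE : IsRep (coeff₂ (shiftProd YM a b c)) G E) {r : ℕ} {h : Fin r → K × K}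
    (hh : ∀ i, h i ∈ checkK K) {d : Fin r → Dist₂ K M} (hd : ∀ i, IsVertexSeries₂ (d i))
    (hj : juxt (YM.field a) (YM.field b) c = ∑ i, mulPowFst (-1) (-h i) (d i))
    (n : Fin r → ℕ × ℕ)
    (hn : ∀ i, IsVertexSeries₂ (mulPowFst (-1) (-natPair K (n i)) (d i))) :
    ∃ E', IsRep (coeff₂ (shiftProd YM a b c)) G E' ∧
      FstBdd E' (fun i => h i - natPair K (n i)) := by
  -- Moving the factor `(ž - w̌)^(n i)` out of the numerator raises the exponent of `ž - w̌` from
  -- `-h i` to `-(h i - n i)`.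
  let κ : Fin r → Lat K := fun i => -(⟨h i, hh i⟩ - latNat K (n i))
  let f : Fin r → Lat K → Lat K → M := fun i P Q =>
    (sg (κ i) * sg P) • coeff₂ (mulPowFst (-1) (-natPair K (n i)) (d i)) P Q
  have hf : ∀ i, SerBdd (f i) := fun i =>
    (serBdd_coeff₂ (hn i)).smul fun P _ => sg (κ i) * sg P
  have hb : TriBdd fun D => ∑ i, ofSeries (κ i) (hf i) D := TriBdd.sum_ofSeries _ _ _
  have hhom : ∀ D, IsHomog D (∑ i, ofSeries (κ i) (hf i) D) := isHomog_sum_ofSeries _ _ _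
  have key : ∀ D, expand (permTri (K := K) (swap₁₃ K) (E D)) =
      expand (∑ i, ofSeries (κ i) (hf i) D) := by
    intro D
    funext Q
    rw [expand_swap₁₃_of_isRep hYM hE, hj, coeff₂_sum, map_sum, Finset.sum_apply,
      Finset.smul_sum]
    refine Finset.sum_congr rfl fun i _ => ?_
    have e1 : -h i = ((κ i + -latNat K (n i) : Lat K) : K × K) := by
      simp only [κ]
      push_cast
      rw [coe_latNat]
      abel
    have e2 : -natPair K (n i) = ((-latNat K (n i) : Lat K) : K × K) := rfl
    rw [expand_ofSeries, e1, ← mulPowFst_mulPowFst (hd i), coeff₂_mulPowFst_neg_one, smul_smul,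
      ← mul_assoc, sg_mul_self, one_mul, sub_add_cancel, ← e2]
    have := congrFun (triOp_smul (mulWt (κ i)) (sg (κ i)) fun B => sg (D - κ i - B) •
      coeff₂ (mulPowFst (-1) (-natPair K (n i)) (d i)) (D - κ i - B) B) Q
    rw [← this]
    simp only [f, smul_smul]
  refine ⟨fun D => permTri (K := K) (swap₁₃ K) (∑ i, ofSeries (κ i) (hf i) D),
    hE.congr (fun D => (hhom D).swap₁₃) hb.swap₁₃ fun D => ?_, fun D t ht => ?_⟩
  · have := expand_swap₁₃_congr (hE.homog D).swap₁₃ (hhom D) (key D)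
    rw [permTri_swap₁₃_swap₁₃] at this
    exact this.symm
  · rw [permTri_apply, Finsupp.finsetSum_apply] at ht
    obtain ⟨i, -, hi⟩ := Finset.exists_ne_zero_of_sum_ne_zero ht
    have h1 := (ofSeries_ne_zero hi).1
    change t.1 = κ i at h1
    refine ⟨i, 0, ?_⟩
    rw [h1]
    simp only [κ]
    push_cast
    rw [coe_latNat, natPair_zero, add_zero]

end Locality

/-! ### Minimality and uniqueness of pole orders. -/

section PoleOrders

variable {K V M : Type*} [Field K] [CharZero K] [AddCommGroup V] [Module K V]
  [AddCommGroup M] [Module K M] {𝒱 : ZMod 2 → Submodule K V} {ℳ : ZMod 2 → Submodule K M}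

theorem intCongr_of_add_natPair_eq {h h' : K × K} {k k' : ℕ × ℕ}
    (e : h + natPair K k = h' + natPair K k') : IntCongr h h' := by
  refine ⟨(k'.1 : ℤ) - k.1, (k'.2 : ℤ) - k.2, ?_⟩
  have : h - h' = natPair K k' - natPair K k := by linear_combination (exp := 1) e
  rw [this]
  simp [natPair]

/-- Two representing families of sums of monomials can be replaced by a single one that satisfies
both bounds. -/
theorem exists_isRep_inf {F G : Lat K → Lat K → M} {E E' : Lat K → Tri K →₀ M}
    (hE : IsRep F G E) (hE' : IsRep F G E') {r s : ℕ} {h : Fin r → K × K} {h' : Fin s → K × K}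
    (hx : FstBdd E h) (hx' : FstBdd E' h') :
    ∃ E₀, IsRep F G E₀ ∧ FstBdd E₀ h ∧ FstBdd E₀ h' := by
  classical
  obtain ⟨S, hS⟩ := hE.bdd.exists_third
  obtain ⟨S', hS'⟩ := hE'.bdd.exists_third
  -- Common representatives for both families: once both are collapsed onto them, equality of the
  -- expansions forces equality of the sums.
  obtain ⟨ρ, hρ, hρ', hρ''⟩ := exists_lower_representatives (S ∪ S')
  have hlow : ∀ a ∈ S ∪ S', ∀ t N, t - latNat K N = a →
      ∃ N, t - latNat K N ∈ (S ∪ S').image ρ := by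
    intro a ha t N hN
    obtain ⟨l, hl⟩ := hρ a ha
    refine ⟨N + l, Finset.mem_image.2 ⟨a, ha, ?_⟩⟩
    rw [map_add, ← sub_sub, hN, eq_sub_iff_add_eq]
    exact hl.symm
  obtain ⟨E₁, hh₁, hb₁, he₁, hS₁, hle₁⟩ := exists_collapse hE.homog hE.bdd ((S ∪ S').image ρ) (by
    intro D t ht
    obtain ⟨N, hN⟩ := hS D t ht
    exact hlow _ (Finset.mem_union_left _ hN) _ N rfl)
  obtain ⟨E₂, hh₂, hb₂, he₂, hS₂, hle₂⟩ := exists_collapse hE'.homog hE'.bdd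
    ((S ∪ S').image ρ) (by
      intro D t ht
      obtain ⟨N, hN⟩ := hS' D t ht
      exact hlow _ (Finset.mem_union_right _ hN) _ N rfl)
  have heq : E₁ = E₂ := by
    funext D
    rw [← sub_eq_zero]
    have hmem : ∀ t, (E₁ D - E₂ D) t ≠ 0 → t.2.2 ∈ (S ∪ S').image ρ := by
      intro t ht
      by_cases h0 : E₁ D t = 0
      · refine hS₂ D t fun h1 => ht ?_
        rw [Finsupp.sub_apply, h0, h1, sub_zero]
      · exact hS₁ D t h0
    refine eq_zero_of_expand_eq_zero ((hh₁ D).sub (hh₂ D)) (fun t u ht hu htu => ?_) ?_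
    · obtain ⟨a, -, ha⟩ := Finset.mem_image.1 (hmem t ht)
      obtain ⟨b, -, hb⟩ := Finset.mem_image.1 (hmem u hu)
      rw [← ha, ← hb] at htu ⊢
      refine hρ' a b ?_
      have := add_mem (sub_mem (hρ'' a) (hρ'' b)) htu
      convert this using 1
      abel
    · rw [map_sub, he₁, he₂, sub_eq_zero]
      funext Q
      rw [hE.fst, hE'.fst]
  exact ⟨E₁, hE.congr hh₁ hb₁ he₁, hx.of_le hle₁, heq ▸ hx'.of_le hle₂⟩

variable {YV : CheckFoldAlgebra 𝒱} {YM : CheckFoldModule 𝒱 ℳ} {a b : V}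

theorem DualWithPoleOrders.dualOfOrdersAtMost {r : ℕ} {h : Fin r → K × K}
    (H : DualWithPoleOrders YV YM a b h) : DualOfOrdersAtMost YV YM a b h := by
  have := (H.2.2 fun _ => 0).2 fun _ => rfl
  simpa only [natPair_zero, sub_zero] using this

theorem sub_natPair_mem_checkK {h : K × K} (hh : h ∈ checkK K) (n : ℕ × ℕ) :
    h - natPair K n ∈ checkK K := (Lat K).sub_mem hh (natPair_mem_lat n)

/-- Any bounds for the duality orders are above the pole orders. -/
theorem DualWithPoleOrders.exists_eq_add {r s : ℕ} {h : Fin r → K × K} {h' : Fin s → K × K}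
    (H : DualWithPoleOrders YV YM a b h) (hh' : ∀ i, h' i ∈ checkK K)
    (hinc : ∀ i j, i ≠ j → ¬ IntCongr (h' i) (h' j))
    (H' : DualOfOrdersAtMost YV YM a b h') (i : Fin r) :
    ∃ i' k, h' i' = h i + natPair K k := by
  classical
  -- Otherwise every monomial of a family satisfying both bounds that is counted for `h i` would
  -- have its exponent above `-h i + e`, and `h i` could be lowered by `e`, against minimality.
  have key : ∀ e : ℕ × ℕ, e ≠ 0 → ∃ i' k k', -h i + natPair K k = -h' i' + natPair K k' ∧
      ¬ e ≤ k := by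
    intro e he
    by_contra! hcon
    have hn := (H.2.2 (Pi.single i e)).1 ((dualOfOrdersAtMost_iff fun j =>
      sub_natPair_mem_checkK (H.1 j) _).2 fun c => ?_) i
    · rw [Pi.single_eq_same] at hn
      exact he hn
    · obtain ⟨E, hE, hx⟩ := (dualOfOrdersAtMost_iff H.1).1 H.dualOfOrdersAtMost c
      obtain ⟨E', hE', hx'⟩ := (dualOfOrdersAtMost_iff hh').1 H' c
      obtain ⟨E₀, hE₀, hx₁, hx₂⟩ := exists_isRep_inf hE hE' hx hx'
      refine ⟨E₀, hE₀, fun D t ht => ?_⟩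
      obtain ⟨j, k, hk⟩ := hx₁ D t ht
      obtain ⟨i', k', hk'⟩ := hx₂ D t ht
      by_cases hj : j = i
      · subst hj
        obtain ⟨l, rfl⟩ := exists_add_of_le (hcon i' k k' (hk.symm.trans hk'))
        refine ⟨j, l, ?_⟩
        rw [hk]
        beta_reduce
        rw [Pi.single_eq_same, natPair_add]
        abel
      · refine ⟨j, k, ?_⟩
        rw [hk]
        beta_reduce
        rw [Pi.single_eq_of_ne hj, natPair_zero, sub_zero]
  -- The two unit vectors control one coordinate each; incongruence of the `h'` shows that both give
  -- the same index, and the witness takes one coordinate from each.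
  obtain ⟨i₁, k₁, l₁, e₁, hk₁⟩ := key (1, 0) (by simp)
  obtain ⟨i₂, k₂, l₂, e₂, hk₂⟩ := key (0, 1) (by simp)
  have hk₁ : k₁.1 = 0 := by simpa [Prod.le_def] using hk₁
  have hk₂ : k₂.2 = 0 := by simpa [Prod.le_def] using hk₂
  have h1 : h' i₁ + natPair K k₁ = h i + natPair K l₁ := by linear_combination (exp := 1) e₁
  have h2 : h' i₂ + natPair K k₂ = h i + natPair K l₂ := by linear_combination (exp := 1) e₂
  have hi : i₁ = i₂ := by
    by_contra hne
    refine hinc i₁ i₂ hne (intCongr_of_add_natPair_eq (k := k₁ + l₂) (k' := k₂ + l₁) ?_)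
    rw [natPair_add, natPair_add]
    linear_combination (exp := 1) h1 - h2
  subst hi
  refine ⟨i₁, (l₁.1, l₂.2), ?_⟩
  have f1 := congrArg Prod.fst h1
  have f2 := congrArg Prod.snd h2
  simp only [natPair, Prod.fst_add, Prod.snd_add, hk₁, hk₂, Nat.cast_zero, add_zero] at f1 f2
  exact Prod.ext f1 f2

theorem intCongr_refl (h : K × K) : IntCongr h h := ⟨0, 0, by simp [← Prod.zero_eq_mk]⟩

/-- Going from `h' i'` up to some `h i` and on to some `h' j` stays in one class modulo `ℤ²`.
Incongruence gives `j = i'`, so both natural shifts vanish. -/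
theorem eq_of_mutual_le {r s : ℕ} {h : Fin r → K × K} {h' : Fin s → K × K}
    (hinc : ∀ i j, i ≠ j → ¬ IntCongr (h' i) (h' j))
    (h1 : ∀ i, ∃ i' k, h' i' = h i + natPair K k) (h2 : ∀ i', ∃ i k, h i = h' i' + natPair K k)
    (i' : Fin s) : ∃ i, h' i' = h i := by
  obtain ⟨i, k, hk⟩ := h2 i'
  obtain ⟨j, l, hl⟩ := h1 i
  rw [hk, add_assoc, ← natPair_add] at hl
  have hj : j = i' := by
    by_contra hne
    refine hinc j i' hne (intCongr_of_add_natPair_eq (k := 0) (k' := k + l) ?_)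
    rw [hl, natPair_zero, add_zero]
  subst hj
  have h0 : natPair K (k + l) = natPair K 0 := by
    rw [natPair_zero]
    linear_combination (exp := 1) -hl
  have hk0 : k = 0 := (add_eq_zero.1 (natPair_injective h0)).1
  refine ⟨i, ?_⟩
  rw [hk, hk0, natPair_zero, add_zero]

theorem exists_equiv_of_values_eq {α β γ : Type*} {f : α → γ} {g : β → γ}
    (hf : Function.Injective f) (hg : Function.Injective g) (h1 : ∀ i, ∃ j, g i = f j)
    (h2 : ∀ j, ∃ i, f j = g i) : ∃ σ : β ≃ α, ∀ i, g i = f (σ i) := by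
  choose σ hσ using h1
  refine ⟨Equiv.ofBijective σ ⟨fun i j hij => hg ?_, fun j => ?_⟩, hσ⟩
  · rw [hσ, hσ, hij]
  · obtain ⟨i, hi⟩ := h2 j
    exact ⟨i, hf (by rw [← hσ, hi])⟩

end PoleOrders

end OPEAlg

/-! ### Locality and equality of the pole orders. -/

theorem mainTheorem3 {K V M : Type*} [Field K] [CharZero K]
    [AddCommGroup V] [Module K V] [AddCommGroup M] [Module K M]
    (𝒱 : ZMod 2 → Submodule K V) [DirectSum.Decomposition 𝒱]
    (ℳ : ZMod 2 → Submodule K M) [DirectSum.Decomposition ℳ]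
    (YV : OPEAlg.CheckFoldAlgebra 𝒱) (hYV : YV.IsBounded)
    (YM : OPEAlg.CheckFoldModule 𝒱 ℳ) (hYM : YM.IsBounded)
    (T T' : V →ₗ[K] V) (hT : OPEAlg.IsEvenOp 𝒱 T) (hT' : OPEAlg.IsEvenOp 𝒱 T')
    (hTM : OPEAlg.IsTranslationEndomorphism YM T T')
    (p q : ZMod 2) (a b : V) (ha : a ∈ 𝒱 p) (hb : b ∈ 𝒱 q)
    (r s : ℕ) (hab : Fin r → K × K) (hba : Fin s → K × K)
    (hdual : OPEAlg.DualWithPoleOrders YV YM a b hab)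
    (hdual' : OPEAlg.DualWithPoleOrders YV YM b a hba)
    (hskew : OPEAlg.SkewSymmetric YV T T' p q a b) :
    OPEAlg.MutuallyLocalWithPoleOrders p q (YM.field a) (YM.field b) hab ∧
      r = s ∧ ∃ σ : Fin s ≃ Fin r, ∀ i, hba i = hab (σ i) := by
  classical
  have hε := OPEAlg.superSign_mul_self (K := K) p q
  have hsk := fun c => OPEAlg.superSign_smul_iterProd hTM hskew c
  have hsk' := fun c =>
    OPEAlg.skew_symm hε (OPEAlg.bddBelowOn_iterProd hYV YM a b c) (hsk c)
  have hab_inj : Function.Injective hab := by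
    intro i j hij
    by_contra hne
    exact hdual.2.1 i j hne (hij ▸ OPEAlg.intCongr_refl _)
  have hba_inj : Function.Injective hba := by
    intro i j hij
    by_contra hne
    exact hdual'.2.1 i j hne (hij ▸ OPEAlg.intCongr_refl _)
  have rep_ab := (OPEAlg.dualOfOrdersAtMost_iff hdual.1).1 hdual.dualOfOrdersAtMost
  have rep_ba := (OPEAlg.dualOfOrdersAtMost_iff hdual'.1).1 hdual'.dualOfOrdersAtMost
  refine ⟨?_, ?_⟩
  · obtain ⟨c, hl, hd, h1, h2⟩ := OPEAlg.exists_ope (YM := YM) (a := a) (b := b)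
      (ε := OPEAlg.superSign K p q) (h := hab) fun v => by
        obtain ⟨E, hE, hx⟩ := rep_ab v
        obtain ⟨E', hE', -⟩ := rep_ba v
        exact OPEAlg.exists_ope_of_isRep hYM hε hE (hE.skew hε hE' (hsk v)) hdual.1 hab_inj hx
    refine ⟨c, ⟨⟨hd, h1⟩, hdual.2.1, fun i n hn hfield => hn ?_⟩, hdual.1, h2⟩
    -- Reducedness: if dividing the `i`-th numerator by `(ž - w̌)^n` left a field, `a` and `b` would
    -- be dual with the `i`-th order lowered by `n`, so minimality of the pole orders gives `n = 0`.
    have := (hdual.2.2 (Pi.single i n)).1 ((OPEAlg.dualOfOrdersAtMost_iff fun j =>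
      OPEAlg.sub_natPair_mem_checkK (hdual.1 j) _).2 fun v => ?_) i
    · rwa [Pi.single_eq_same] at this
    · obtain ⟨E, hE, -⟩ := rep_ab v
      refine OPEAlg.exists_isRep_of_ope hYM hE hdual.1 (fun i => hd i v) (h1 v) _ fun j => ?_
      by_cases hj : j = i
      · subst hj
        rw [Pi.single_eq_same]
        exact hfield v
      · rw [Pi.single_eq_of_ne hj]
        have e : OPEAlg.mulPowFst (-1) (-OPEAlg.natPair K 0) (c j v) = c j v := by
          refine ((hl j v).mulPowFst _ (neg_mem (OPEAlg.natPair_mem_lat 0))).ext (hl j v) ?_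
          have h0 : -OPEAlg.natPair K 0 = ((0 : OPEAlg.Lat K) : K × K) := by
            rw [OPEAlg.natPair_zero, neg_zero]
            rfl
          funext P Q
          rw [h0, OPEAlg.coeff₂_mulPowFst_neg_one, OPEAlg.triOp_mulWt_zero, OPEAlg.sg_zero,
            mul_one, sub_zero, add_sub_cancel_right, smul_smul, OPEAlg.sg_mul_self, one_smul]
        rw [e]
        exact hd j v
  -- The skew exchange fixes the first variable, so the bounds for `a, b` also hold for `b, a`, and
  -- conversely.
  · have dual_ba : OPEAlg.DualOfOrdersAtMost YV YM b a hab :=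
      (OPEAlg.dualOfOrdersAtMost_iff hdual.1).2 fun v => by
        obtain ⟨E, hE, hx⟩ := rep_ab v
        obtain ⟨E', hE', -⟩ := rep_ba v
        exact ⟨_, hE.skew hε hE' (hsk v), hx.skew _⟩
    have dual_ab : OPEAlg.DualOfOrdersAtMost YV YM a b hba :=
      (OPEAlg.dualOfOrdersAtMost_iff hdual'.1).2 fun v => by
        obtain ⟨E, hE, hx⟩ := rep_ba v
        obtain ⟨E', hE', -⟩ := rep_ab v
        exact ⟨_, hE.skew hε hE' (hsk' v), hx.skew _⟩
    have le₁ := hdual.exists_eq_add hdual'.1 hdual'.2.1 dual_ab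
    have le₂ := hdual'.exists_eq_add hdual.1 hdual.2.1 dual_ba
    obtain ⟨σ, hσ⟩ := OPEAlg.exists_equiv_of_values_eq hab_inj hba_inj
      (OPEAlg.eq_of_mutual_le hdual'.2.1 le₁ le₂) (OPEAlg.eq_of_mutual_le hdual.2.1 le₂ le₁)
    refine ⟨?_, σ, hσ⟩
    simpa using (Fintype.card_congr σ).symm
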